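/- Let $G$ be a finite group, let $\pi$ be a set of primes and $\pi'$ the complementary set of primes. For a finite group $X$ and a set $\sigma$ of primes let $O_\sigma(X)$ be the largest normal $\sigma$-subgroup of $X$, and let $O_{\sigma_1\cdots\sigma_k}(X)$ be the preimage in $X$ of $O_{\sigma_k}(X/O_{\sigma_1\cdots\sigma_{k-1}}(X))$. Assume $G=O_{\pi'\pi\pi'}(G)$, let $N=O_{\pi'}(G)$, let $H$ be a Hall $\pi$-subgroup of $G$ (so $|H|$ is a $\pi$-number and $|G:H|$ is a $\pi'$-number), and let $c\in H^2G=Z^2(G,\mathbb C^\times)/B^2(G,\mathbb C^\times)$ (trivial action). Let $\alpha$ be any cocycle with class $c$; everything below is independent of its choice. Write $x^g=g^{-1}xg$ and $\alpha_{x,g}=\alpha(x,g)\,\alpha(g,x^g)^{-1}$. For $K\le G$, a $c$-module of $K$ is a finite-dimensional complex vector space $V$ with a map $\varphi:K\to\mathrm{GL}(V)$ such that $\varphi(x)\varphi(y)=\alpha(x,y)\varphi(xy)$ for all $x,y\in K$; it is irreducible if $V\ne0$ and $0,V$ are the only $\varphi(K)$-invariant subspaces, and its degree is $\dim V$. For an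 irreducible $c$-module $V$ of $N$, its inertia group with respect to $c$ is $$G_{c,V}=\{g\in G:\ \exists\, y\in \mathrm{GL}(V)\ \text{with}\ y^{-1}\varphi(x)y=\alpha_{x,g}\,\varphi(x^g)\ \text{for all}\ x\in N\}.$$ An element $x\in N$ is $c$-regular in $N$ if its class sum $|C_N(x)|^{-1}\sum_{g\in N}\alpha_{x,g}\,x^g\sigma$ is nonzero in the twisted group algebra of $N$ (with basis $\{n\sigma: n\in N\}$ and product $m\sigma\, n\sigma=\alpha(m,n)\,(mn)\sigma$); this is a property of the conjugacy class of $x$ in $N$. Let $\mathrm{Cl}(N|c)$ be the set of conjugacy classes of $N$ of $c$-regular elements; $G$ acts by conjugation on the classes of $N$, with stabilizers $G_\tau$. Then the following are equivalent: (i) no prime in $\pi$ divides the degree of an irreducible $c$-module of $G$; (ii) $H$ is abelian, the restriction of $c$ to $H^2H$ is trivial, and $H\le G_{c,V}$ for every irreducible $c$-module $V$ of $N$; (iii) $H$ is abelian, the restriction of $c$ to $H^2H$ is trivial, and $H\le G_\tau$ for every $\tau\in\mathrm{Cl}(N|c)$. -/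

import Mathlib

universe u

/-! ### Sets of primes, Hall subgroups and the groups `O_π` -/

/-- `Π(n)`: the set of prime divisors of `n`. Sets of primes are `π : Set Nat.Primes`, and `π'` is
the complement `πᶜ`. -/
def primeDivisors (n : ℕ) : Set Nat.Primes := {p | (p : ℕ) ∣ n}

/-- `H` is a Hall `π`-subgroup of `G`: `|H|` is a `π`-number and `|G : H|` is a `π'`-number. -/
def IsHallSubgroup {G : Type u} [Group G] (π : Set Nat.Primes) (H : Subgroup G) : Prop :=
  primeDivisors (Nat.card H) ⊆ π ∧ primeDivisors H.index ⊆ πᶜ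

/-- `O_π(G)`: the largest normal `π`-subgroup of the finite group `G`, as the subgroup generated by
all normal `π`-subgroups. -/
def piCore (π : Set Nat.Primes) (G : Type u) [Group G] : Subgroup G :=
  sSup {N : Subgroup G | N.Normal ∧ primeDivisors (Nat.card N) ⊆ π}

instance piCore_normal (π : Set Nat.Primes) (G : Type u) [Group G] : (piCore π G).Normal :=
  Subgroup.sSup_normal _ fun _ hN => hN.1

/-- The preimage in `G` of `O_π(G/N)`. So `O_{π₁π₂}(G) = piCoreAbove (piCore π₁ G) π₂`, and so on. -/
def piCoreAbove {G : Type u} [Group G] (N : Subgroup G) [N.Normal] (π : Set Nat.Primes) :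
    Subgroup G :=
  (piCore π (G ⧸ N)).comap (QuotientGroup.mk' N)

instance piCoreAbove_normal {G : Type u} [Group G] (N : Subgroup G) [N.Normal]
    (π : Set Nat.Primes) : (piCoreAbove N π).Normal :=
  Subgroup.Normal.comap (piCore_normal π (G ⧸ N)) _

/-- `O_{π₁π₂π₃}(G)`. -/
def piCoreThree (π₁ π₂ π₃ : Set Nat.Primes) (G : Type u) [Group G] : Subgroup G :=
  piCoreAbove (piCoreAbove (piCore π₁ G) π₂) π₃

/-! ### The Schur multiplier -/

/-- `Z²G`: the group of cocycles `G × G → ℂˣ` (trivial action), under pointwise multiplication. -/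
def Z2 (G : Type u) [Group G] : Subgroup (G → G → ℂˣ) where
  carrier := {α | ∀ x y z, α x y * α (x * y) z = α x (y * z) * α y z}
  one_mem' := by intro x y z; simp
  mul_mem' := by
    intro α β hα hβ x y z
    have h : (α x y * α (x * y) z) * (β x y * β (x * y) z)
        = (α x (y * z) * α y z) * (β x (y * z) * β y z) := by rw [hα x y z, hβ x y z]
    simpa only [Pi.mul_apply, mul_mul_mul_comm] using h
  inv_mem' := by
    intro α hα x y z
    simpa only [Pi.inv_apply, mul_inv] using congrArg (fun t => t⁻¹) (hα x y z)

/-- The coboundary `δζ` of a function `ζ : G → ℂˣ`. -/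
def coboundary {G : Type u} [Group G] (ζ : G → ℂˣ) : Z2 G :=
  ⟨fun x y => ζ x * ζ y * (ζ (x * y))⁻¹, by
    intro x y z
    simp only [mul_assoc x y z]
    generalize ζ (x * (y * z)) = d
    apply Units.ext
    push_cast
    field_simp⟩

/-- `B²G`: the subgroup of coboundaries in `Z²G`. -/
def B2 (G : Type u) [Group G] : Subgroup (Z2 G) where
  carrier := Set.range coboundary
  one_mem' := ⟨1, by ext x y; simp [coboundary]⟩
  mul_mem' := by
    rintro _ _ ⟨ζ, rfl⟩ ⟨η, rfl⟩
    refine ⟨ζ * η, Subtype.ext (funext fun x => funext fun y => ?_)⟩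
    simp only [coboundary, Pi.mul_apply, Subgroup.coe_mul, mul_inv]
    simp only [mul_mul_mul_comm]
  inv_mem' := by
    rintro _ ⟨ζ, rfl⟩
    refine ⟨ζ⁻¹, Subtype.ext (funext fun x => funext fun y => ?_)⟩
    simp only [coboundary, Pi.inv_apply, Subgroup.coe_inv, mul_inv]

/-- The Schur multiplier `H²G = Z²G / B²G`. Its elements are the coclasses. -/
abbrev SchurMultiplier (G : Type u) [Group G] : Type u := Z2 G ⧸ B2 G

/-- The coclass `[α]` of a cocycle `α`. -/
def coclass {G : Type u} [Group G] (α : Z2 G) : SchurMultiplier G := QuotientGroup.mk α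

/-- The restriction of cocycles `Z²G → Z²H`. -/
def Z2.res {G : Type u} [Group G] (H : Subgroup G) : Z2 G →* Z2 H where
  toFun α := ⟨fun x y => α.1 x y, fun x y z => α.2 x y z⟩
  map_one' := rfl
  map_mul' _ _ := rfl

/-- The restriction of coclasses `H²G → H²H`, `[α] ↦ [α|_H]`. -/
def SchurMultiplier.res {G : Type u} [Group G] (H : Subgroup G) :
    SchurMultiplier G →* SchurMultiplier H :=
  QuotientGroup.map (B2 G) (B2 H) (Z2.res H) (by
    rintro _ ⟨ζ, rfl⟩
    exact ⟨fun x => ζ x, rfl⟩)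

/-- The scalar `α(x, g) α(g, x ^ g)⁻¹`, where `x ^ g = g⁻¹ x g`. In the twisted group algebra, with
basis `Gσ` and product `gσ hσ = α(g, h) (gh)σ`, this is the scalar with
`(gσ)⁻¹ (xσ) (gσ) = α(x, g) α(g, x ^ g)⁻¹ (x ^ g)σ`. -/
def conjScalar {G : Type u} [Group G] (α : Z2 G) (x g : G) : ℂˣ :=
  α.1 x g * (α.1 g (g⁻¹ * x * g))⁻¹

/-! ### Modules over a coclass -/

/-- A map `φ : G → GL(V)` with cocycle `α`: `φ(x) φ(y) = α(x, y) φ(xy)`. If `V` has finite dimension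
then `φ` makes `V` into an `[α]`-module of `G` (a module over the twisted group algebra of `α`). -/
structure TwistedRep {G : Type u} [Group G] (α : Z2 G) (V : Type) [AddCommGroup V] [Module ℂ V]
    where
  toFun : G → (V ≃ₗ[ℂ] V)
  map_mul' : ∀ x y v, toFun x (toFun y v) = (α.1 x y : ℂ) • toFun (x * y) v

/-- `V` is irreducible: it is nonzero, and `0` and `V` are its only invariant subspaces. -/
def TwistedRep.IsIrreducible {G : Type u} [Group G] {α : Z2 G} {V : Type} [AddCommGroup V]
    [Module ℂ V] (φ : TwistedRep α V) : Prop :=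
  Nontrivial V ∧ ∀ W : Submodule ℂ V, (∀ g, ∀ v ∈ W, φ.toFun g v ∈ W) → W = ⊥ ∨ W = ⊤

/-- `Π(Irr(G|c))`: the primes that divide the degree of some irreducible `c`-module of `G`. -/
def irrDegreePrimes {G : Type u} [Group G] (c : SchurMultiplier G) : Set Nat.Primes :=
  {p | ∃ α : Z2 G, coclass α = c ∧
    ∃ (V : Type) (_ : AddCommGroup V) (_ : Module ℂ V) (_ : FiniteDimensional ℂ V)
      (φ : TwistedRep α V), φ.IsIrreducible ∧ p ∈ primeDivisors (Module.finrank ℂ V)}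

/-- The inertia group in `G` of a module `V` of the normal subgroup `N`, given by
`φ : N → GL(V)` with cocycle `α|_N`: the `g ∈ G` such that, for some `y ∈ GL(V)`,
`y⁻¹ φ(x) y = α(x, g) α(g, x ^ g)⁻¹ φ(x ^ g)` for all `x ∈ N`. -/
def inertia {G : Type u} [Group G] (α : Z2 G) (N : Subgroup G) [N.Normal] {V : Type}
    [AddCommGroup V] [Module ℂ V] (φ : TwistedRep (Z2.res N α) V) : Set G :=
  {g | ∃ y : V ≃ₗ[ℂ] V, ∀ (x : N) (v : V),
    y.symm (φ.toFun x (y v)) = (conjScalar α x g : ℂ) • φ.toFun (MulAut.conjNormal g⁻¹ x) v}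

/-- `H` is contained in the inertia group of every irreducible `c`-module of `N`, where
`c ∈ H²G`. -/
def StabilizesIrr {G : Type u} [Group G] (c : SchurMultiplier G) (H N : Subgroup G) [N.Normal] :
    Prop :=
  ∀ α : Z2 G, coclass α = c →
    ∀ (V : Type) [AddCommGroup V] [Module ℂ V] [FiniteDimensional ℂ V]
      (φ : TwistedRep (Z2.res N α) V), φ.IsIrreducible → (H : Set G) ⊆ inertia α N φ

/-! ### Regular classes -/

/-- The class sum `|G_x|⁻¹ ∑_g (gσ)⁻¹ (xσ) (gσ)` of the finite group `G` in the twisted group algebra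
of `α`, as a vector in the coordinates of the basis `Gσ`; `G_x` is the centralizer of `x`. -/
noncomputable def classSum {G : Type u} [Group G] (α : Z2 G) (x : G) : G →₀ ℂ :=
  (Nat.card (Subgroup.centralizer {x}) : ℂ)⁻¹ •
    ∑ᶠ g : G, Finsupp.single (g⁻¹ * x * g) (conjScalar α x g : ℂ)

/-- `x` is `c`-regular: its class sum is nonzero. -/
def IsRegularElement {G : Type u} [Group G] (c : SchurMultiplier G) (x : G) : Prop :=
  ∃ α : Z2 G, coclass α = c ∧ classSum α x ≠ 0

/-- `Cl(G|c)`: the conjugacy classes of the `c`-regular elements. -/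
def regularClasses {G : Type u} [Group G] (c : SchurMultiplier G) : Set (ConjClasses G) :=
  {τ | ∃ x : G, IsRegularElement c x ∧ ConjClasses.mk x = τ}

/-- `G_τ`: the stabilizer of a conjugacy class `τ` of the normal subgroup `N` under conjugation by
elements of `G`. -/
def classStabilizer {G : Type u} [Group G] {N : Subgroup G} [N.Normal] (τ : ConjClasses N) :
    Subgroup G where
  carrier := {g | ConjClasses.map (MulAut.conjNormal g : MulAut N).toMonoidHom τ = τ}
  one_mem' := by
    induction τ using Quotient.inductionOn with
    | h x => exact congrArg ConjClasses.mk (by simp)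
  mul_mem' := by
    intro a b ha hb
    have key : ConjClasses.map (MulAut.conjNormal (a * b) : MulAut N).toMonoidHom τ
        = ConjClasses.map (MulAut.conjNormal a : MulAut N).toMonoidHom
          (ConjClasses.map (MulAut.conjNormal b : MulAut N).toMonoidHom τ) := by
      induction τ using Quotient.inductionOn with
      | h x => exact congrArg ConjClasses.mk (by simp)
    simp only [Set.mem_ofPred_eq] at ha hb ⊢
    rw [key, hb, ha]
  inv_mem' := by
    intro a ha
    have key : ConjClasses.map (MulAut.conjNormal a⁻¹ : MulAut N).toMonoidHom
        (ConjClasses.map (MulAut.conjNormal a : MulAut N).toMonoidHom τ) = τ := by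
      induction τ using Quotient.inductionOn with
      | h x => exact congrArg ConjClasses.mk (by simp)
    simp only [Set.mem_ofPred_eq] at ha ⊢
    rw [ha] at key
    exact key

/-! Put M = O_{π'π}(G). The hypothesis makes |G : M| a π'-number, so H ≤ M and M = NH, with |N| and
|H| coprime. By Clifford theory, the degree of an irreducible module of G is the degree of a
constituent on M times a divisor of |G : M| (`exists_finrank_eq_mul`). So (i) says that all
irreducible c-modules of M have π'-degree.

(i) ⇒ (ii). The degree of an irreducible module of M over that of a constituent on N divides the
π-number |M : N|, so a π'-degree forces the restriction to N to be irreducible. Every irreducible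
module of N therefore extends to M and is stable under M ≥ H. Two irreducible modules of M sharing a
constituent on N differ by a linear character of M, which is trivial on commutators. If some
commutator lay outside N, a nonzero element of the twisted group algebra supported on two cosets of
N would act as zero everywhere (`commutator_mem_of_forall_irreducible`). So M/N, hence H, is
abelian. Determinants show that c restricted to H is killed by a degree prime to |H|, and it is
always killed by |H|.

(ii) ⇒ (i). Let W be an irreducible module of M over an irreducible module S of N. The operators by
which H stabilizes S commute up to scalars whose orders divide both dim S and |H|, and dim S divides
|N|; so they commute (`apply_comm_of_coprime`). As H is abelian and c is trivial on it, α is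
symmetric on H, and H acts on Hom_N(S, W) by commuting operators. A common eigenvector has an
M-invariant image, so dim W = dim S (`finrank_eq_of_stable`).

(ii) ⇔ (iii). Irreducible characters of N vanish off the regular classes. If h ∈ H fixes the class
of x, some element of hN centralizes x and has order dividing |H|; coprimality makes its conjugation
scalar on x equal to 1, so each character is h-stable at x (`trace_eq_of_isConj`). Conversely,
stability makes all irreducible characters proportional at x and at a conjugate of x by H, with one
common factor, whereas they separate a regular class from any other class
(`exists_conj_eq_of_forall_trace_eq`). -/

open Module

/-! ### Intertwiners, Schur's lemma and orthogonality for twisted representations -/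

section TwistedRepresentations

variable {G : Type*} [Group G] {U V W : Type*} [AddCommGroup U] [Module ℂ U]
  [AddCommGroup V] [Module ℂ V] [AddCommGroup W] [Module ℂ W]

/-- `φ` restricts to a representation of the subgroup `K` that is twisted by `α`. -/
def IsTwistedOn (α : G → G → ℂˣ) (K : Subgroup G) (φ : G → V ≃ₗ[ℂ] V) : Prop :=
  ∀ x ∈ K, ∀ y ∈ K, ∀ v, φ x (φ y v) = (α x y : ℂ) • φ (x * y) v

/-- `V` is nonzero and has no proper nonzero subspace invariant under `φ x` for all `x ∈ K`. -/
def IsIrreducibleOn (K : Subgroup G) (φ : G → V ≃ₗ[ℂ] V) : Prop :=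
  Nontrivial V ∧ ∀ X : Submodule ℂ V, (∀ x ∈ K, ∀ v ∈ X, φ x v ∈ X) → X = ⊥ ∨ X = ⊤

/-- The linear maps that intertwine the actions of `K`. -/
def homOn (K : Subgroup G) (ψ : G → W ≃ₗ[ℂ] W) (φ : G → V ≃ₗ[ℂ] V) : Submodule ℂ (W →ₗ[ℂ] V) where
  carrier := {f | ∀ x ∈ K, ∀ w, f (ψ x w) = φ x (f w)}
  zero_mem' := by intro x _ w; simp
  add_mem' := by intro f g hf hg x hx w; simp [hf x hx w, hg x hx w]
  smul_mem' := by intro c f hf x hx w; simp [hf x hx w]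

lemma IsTwistedOn.mono {α : G → G → ℂˣ} {K L : Subgroup G} {φ : G → V ≃ₗ[ℂ] V}
    (h : IsTwistedOn α L φ) (hKL : K ≤ L) : IsTwistedOn α K φ :=
  fun x hx y hy => h x (hKL hx) y (hKL hy)

lemma homOn_comp {K : Subgroup G} {θ : G → U ≃ₗ[ℂ] U} {ψ : G → W ≃ₗ[ℂ] W} {φ : G → V ≃ₗ[ℂ] V}
    {f : W →ₗ[ℂ] V} {g : U →ₗ[ℂ] W} (hf : f ∈ homOn K ψ φ) (hg : g ∈ homOn K θ ψ) :
    f ∘ₗ g ∈ homOn K θ φ := by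
  intro x hx u
  simp [hg x hx u, hf x hx (g u)]

/-! ### Schur's lemma -/

lemma injective_of_mem_homOn {K : Subgroup G} {ψ : G → W ≃ₗ[ℂ] W} {φ : G → V ≃ₗ[ℂ] V}
    (hψ : IsIrreducibleOn K ψ) {f : W →ₗ[ℂ] V} (hf : f ∈ homOn K ψ φ) (h0 : f ≠ 0) :
    Function.Injective f := by
  rw [← LinearMap.ker_eq_bot]
  refine (hψ.2 (LinearMap.ker f) fun x hx w hw => ?_).resolve_right fun h => h0 ?_
  · rw [LinearMap.mem_ker] at hw ⊢
    rw [hf x hx, hw, map_zero]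
  · exact LinearMap.ker_eq_top.1 h

lemma surjective_of_mem_homOn {K : Subgroup G} {ψ : G → W ≃ₗ[ℂ] W} {φ : G → V ≃ₗ[ℂ] V}
    (hφ : IsIrreducibleOn K φ) {f : W →ₗ[ℂ] V} (hf : f ∈ homOn K ψ φ) (h0 : f ≠ 0) :
    Function.Surjective f := by
  rw [← LinearMap.range_eq_top]
  refine (hφ.2 (LinearMap.range f) ?_).resolve_left fun h => h0 (LinearMap.range_eq_bot.1 h)
  rintro x hx _ ⟨w, rfl⟩
  exact ⟨ψ x w, hf x hx w⟩

lemma exists_smul_of_mem_homOn [FiniteDimensional ℂ V] {K : Subgroup G} {φ : G → V ≃ₗ[ℂ] V}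
    (hφ : IsIrreducibleOn K φ) {f : V →ₗ[ℂ] V} (hf : f ∈ homOn K φ φ) :
    ∃ c : ℂ, ∀ v, f v = c • v := by
  have := hφ.1
  obtain ⟨c, hc⟩ := Module.End.exists_eigenvalue f
  refine ⟨c, fun v => ?_⟩
  have h := (hφ.2 (Module.End.eigenspace f c) fun x hx v hv => ?_).resolve_left hc
  · have hv : v ∈ Module.End.eigenspace f c := h ▸ Submodule.mem_top
    exact Module.End.mem_eigenspace_iff.1 hv
  · rw [Module.End.mem_eigenspace_iff] at hv ⊢
    rw [hf x hx, hv, map_smul]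

/-- The quotient `z * y⁻¹` commutes with an irreducible action, so Schur's lemma applies. This is
why stabilizing operators are unique up to scalars and define projective representations. -/
lemma exists_units_smul_of_conj_eq [FiniteDimensional ℂ V] {K : Subgroup G} {φ : G → V ≃ₗ[ℂ] V}
    (hφ : IsIrreducibleOn K φ) {y z : V ≃ₗ[ℂ] V}
    (h : ∀ x ∈ K, ∀ v, y.symm (φ x (y v)) = z.symm (φ x (z v))) :
    ∃ c : ℂˣ, ∀ v, z v = (c : ℂ) • y v := by
  have := hφ.1
  obtain ⟨c, hc⟩ := exists_smul_of_mem_homOn hφ (f := (z * y⁻¹ : V ≃ₗ[ℂ] V).toLinearMap) (by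
    intro x hx v
    have h1 := h x hx (y.symm v)
    rw [LinearEquiv.apply_symm_apply] at h1
    change z (y.symm (φ x v)) = φ x (z (y.symm v))
    rw [h1, LinearEquiv.apply_symm_apply])
  have hz : ∀ v, z v = c • y v := fun v => by
    have h1 : z (y.symm (y v)) = c • y v := hc (y v)
    rwa [LinearEquiv.symm_apply_apply] at h1
  have hc0 : c ≠ 0 := by
    rintro rfl
    obtain ⟨v, hv⟩ := exists_ne (0 : V)
    exact hv (z.injective (by rw [hz, zero_smul, map_zero]))
  exact ⟨Units.mk0 c hc0, hz⟩

/-! ### Averaging -/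

/-- The sum of the conjugates of `f` under the elements of `K`. -/
noncomputable def averageOn (K : Subgroup G) [Fintype K] (ψ : G → W ≃ₗ[ℂ] W) (φ : G → V ≃ₗ[ℂ] V) :
    (W →ₗ[ℂ] V) →ₗ[ℂ] (W →ₗ[ℂ] V) :=
  ∑ g : K, ((ψ g).arrowCongr (φ g)).toLinearMap

lemma averageOn_apply (K : Subgroup G) [Fintype K] (ψ : G → W ≃ₗ[ℂ] W) (φ : G → V ≃ₗ[ℂ] V)
    (f : W →ₗ[ℂ] V) (w : W) : averageOn K ψ φ f w = ∑ g : K, φ g (f ((ψ g).symm w)) := by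
  simp [averageOn, LinearMap.sum_apply, LinearEquiv.arrowCongr_apply]

lemma IsTwistedOn.symm_apply_apply {α : G → G → ℂˣ} {K : Subgroup G} {ψ : G → W ≃ₗ[ℂ] W}
    (hψ : IsTwistedOn α K ψ) {x y : G} (hx : x ∈ K) (hy : y ∈ K) (w : W) :
    (ψ (x * y)).symm (ψ x w) = (α x y : ℂ) • (ψ y).symm w := by
  rw [LinearEquiv.symm_apply_eq, map_smul, ← hψ x hx y hy, LinearEquiv.apply_symm_apply]

/-- Both representations have the same cocycle, so the factors α(x, g) produced by translating the
summation variable agree on the two sides. -/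
lemma averageOn_mem_homOn {α : G → G → ℂˣ} {K : Subgroup G} [Fintype K] {ψ : G → W ≃ₗ[ℂ] W}
    {φ : G → V ≃ₗ[ℂ] V} (hψ : IsTwistedOn α K ψ) (hφ : IsTwistedOn α K φ) (f : W →ₗ[ℂ] V) :
    averageOn K ψ φ f ∈ homOn K ψ φ := by
  intro x hx w
  rw [averageOn_apply, averageOn_apply, map_sum, ← Equiv.sum_comp (Equiv.mulLeft (⟨x, hx⟩ : K))]
  refine Finset.sum_congr rfl fun g _ => ?_
  rw [Equiv.coe_mulLeft, Subgroup.coe_mul, hψ.symm_apply_apply hx g.2, hφ x hx g g.2, map_smul,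
    map_smul]

lemma averageOn_of_mem_homOn {K : Subgroup G} [Fintype K] {ψ : G → W ≃ₗ[ℂ] W}
    {φ : G → V ≃ₗ[ℂ] V} {f : W →ₗ[ℂ] V} (hf : f ∈ homOn K ψ φ) :
    averageOn K ψ φ f = (Nat.card K : ℂ) • f := by
  ext w
  rw [averageOn_apply, LinearMap.smul_apply]
  have : ∀ g : K, φ g (f ((ψ g).symm w)) = f w := fun g => by
    rw [← hf g g.2, LinearEquiv.apply_symm_apply]
  simp [this, Nat.cast_smul_eq_nsmul]

/-- W and V are ordinary representations of GL(W) × GL(V) through its two projections; this is the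
character of Hom(W, V) at (a, b). -/
lemma trace_arrowCongr [FiniteDimensional ℂ V] [FiniteDimensional ℂ W] (a : W ≃ₗ[ℂ] W)
    (b : V ≃ₗ[ℂ] V) :
    LinearMap.trace ℂ (W →ₗ[ℂ] V) (a.arrowCongr b).toLinearMap
      = LinearMap.trace ℂ W a.symm.toLinearMap * LinearMap.trace ℂ V b.toLinearMap := by
  let ρ : Representation ℂ ((W ≃ₗ[ℂ] W) × (V ≃ₗ[ℂ] V)) W :=
    (LinearEquiv.automorphismGroup.toLinearMapMonoidHom).comp (MonoidHom.fst _ _)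
  let σ : Representation ℂ ((W ≃ₗ[ℂ] W) × (V ≃ₗ[ℂ] V)) V :=
    (LinearEquiv.automorphismGroup.toLinearMapMonoidHom).comp (MonoidHom.snd _ _)
  exact Representation.char_linHom ρ σ (a, b)

/-- Averaging, divided by |K|, is a projection onto the intertwiners, and the trace of a projection
is its rank. -/
lemma sum_trace_mul_trace [FiniteDimensional ℂ V] [FiniteDimensional ℂ W] {α : G → G → ℂˣ}
    {K : Subgroup G} [Fintype K] {ψ : G → W ≃ₗ[ℂ] W} {φ : G → V ≃ₗ[ℂ] V}
    (hψ : IsTwistedOn α K ψ) (hφ : IsTwistedOn α K φ) :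
    ∑ g : K, LinearMap.trace ℂ W (ψ g).symm.toLinearMap * LinearMap.trace ℂ V (φ g).toLinearMap
      = Nat.card K * finrank ℂ (homOn K ψ φ) := by
  have h0 : (Nat.card K : ℂ) ≠ 0 := Nat.cast_ne_zero.2 Nat.card_pos.ne'
  have hp : LinearMap.IsProj (homOn K ψ φ) ((Nat.card K : ℂ)⁻¹ • averageOn K ψ φ) := by
    refine ⟨fun f => ?_, fun f hf => ?_⟩
    · exact Submodule.smul_mem _ _ (averageOn_mem_homOn hψ hφ f)
    · rw [LinearMap.smul_apply, averageOn_of_mem_homOn hf, smul_smul, inv_mul_cancel₀ h0, one_smul]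
  have h := hp.trace
  rw [map_smul, smul_eq_mul, inv_mul_eq_iff_eq_mul₀ h0] at h
  rw [← h, averageOn, map_sum]
  exact Finset.sum_congr rfl fun g _ => (trace_arrowCongr _ _).symm

/-- Schur orthogonality in one irreducible representation. -/
lemma averageOn_apply_self [FiniteDimensional ℂ W] {α : G → G → ℂˣ} {K : Subgroup G}
    [Fintype K] {ψ : G → W ≃ₗ[ℂ] W} (hψ : IsTwistedOn α K ψ) (hi : IsIrreducibleOn K ψ)
    (f : W →ₗ[ℂ] W) (w : W) :
    averageOn K ψ ψ f w
      = ((Nat.card K : ℂ) / finrank ℂ W * LinearMap.trace ℂ W f) • w := by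
  have := hi.1
  obtain ⟨c, hc⟩ := exists_smul_of_mem_homOn hi (averageOn_mem_homOn hψ hψ f)
  have h1 : averageOn K ψ ψ f = c • (1 : W →ₗ[ℂ] W) := LinearMap.ext hc
  have h2 : LinearMap.trace ℂ W (averageOn K ψ ψ f) = Nat.card K * LinearMap.trace ℂ W f := by
    rw [averageOn, LinearMap.sum_apply, map_sum]
    have : ∀ g : K, LinearMap.trace ℂ W (((ψ g).arrowCongr (ψ g)).toLinearMap f)
        = LinearMap.trace ℂ W f := fun g => LinearMap.trace_conj' f (ψ g)
    rw [Finset.sum_congr rfl fun g _ => this g]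
    simp
  rw [h1, map_smul, LinearMap.trace_one, smul_eq_mul] at h2
  have h3 : (finrank ℂ W : ℂ) ≠ 0 := Nat.cast_ne_zero.2 finrank_pos.ne'
  rw [hc, div_mul_eq_mul_div, ← h2, mul_div_cancel_right₀ _ h3]

/-- The operator of the class function of `ψ`, multiplied by `B`, on another representation. -/
noncomputable def traceOperator (K : Subgroup G) [Fintype K] (ψ : G → W ≃ₗ[ℂ] W)
    (φ : G → V ≃ₗ[ℂ] V) (B : W →ₗ[ℂ] W) : V →ₗ[ℂ] V :=
  ∑ g : K, LinearMap.trace ℂ W ((ψ g).symm.toLinearMap ∘ₗ B) • (φ g).toLinearMap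

lemma traceOperator_apply (K : Subgroup G) [Fintype K] (ψ : G → W ≃ₗ[ℂ] W)
    (φ : G → V ≃ₗ[ℂ] V) (B : W →ₗ[ℂ] W) (v : V) : traceOperator K ψ φ B v =
      ∑ g : K, LinearMap.trace ℂ W ((ψ g).symm.toLinearMap ∘ₗ B) • φ g v := by
  simp [traceOperator, LinearMap.sum_apply]

/-- Expanding the trace in a basis writes the operator through averages of rank-one maps. Hence its
values lie in the images of intertwiners, and Schur orthogonality evaluates it. -/
lemma traceOperator_eq_sum_averageOn {ι : Type*} [Fintype ι] (b : Basis ι ℂ W)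
    (K : Subgroup G) [Fintype K] (ψ : G → W ≃ₗ[ℂ] W) (φ : G → V ≃ₗ[ℂ] V) (B : W →ₗ[ℂ] W) (v : V) :
    traceOperator K ψ φ B v = ∑ i, averageOn K ψ φ ((b.coord i).smulRight v) (B (b i)) := by
  classical
  simp only [traceOperator_apply, averageOn_apply, LinearMap.smulRight_apply, map_smul]
  rw [Finset.sum_comm]
  refine Finset.sum_congr rfl fun g _ => ?_
  rw [← Finset.sum_smul, LinearMap.trace_eq_matrix_trace ℂ b, Matrix.trace]
  simp [LinearMap.toMatrix_apply]

lemma traceOperator_self [FiniteDimensional ℂ W] {α : G → G → ℂˣ} {K : Subgroup G}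
    [Fintype K] {ψ : G → W ≃ₗ[ℂ] W} (hψ : IsTwistedOn α K ψ) (hi : IsIrreducibleOn K ψ)
    (B : W →ₗ[ℂ] W) (w : W) :
    traceOperator K ψ ψ B w = ((Nat.card K : ℂ) / finrank ℂ W) • B w := by
  rw [traceOperator_eq_sum_averageOn (finBasis ℂ W)]
  simp only [averageOn_apply_self hψ hi, LinearMap.trace_smulRight, mul_smul]
  rw [← Finset.smul_sum]
  simp only [← map_smul, ← map_sum]
  simp only [Basis.coord_apply, Basis.sum_repr]

lemma traceOperator_apply_hom [FiniteDimensional ℂ W] {α : G → G → ℂˣ} {K : Subgroup G}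
    [Fintype K] {ψ : G → W ≃ₗ[ℂ] W} (hψ : IsTwistedOn α K ψ) (hi : IsIrreducibleOn K ψ)
    {φ : G → V ≃ₗ[ℂ] V} {f : W →ₗ[ℂ] V} (hf : f ∈ homOn K ψ φ) (B : W →ₗ[ℂ] W) (w : W) :
    traceOperator K ψ φ B (f w) = ((Nat.card K : ℂ) / finrank ℂ W) • f (B w) := by
  rw [← map_smul, ← traceOperator_self hψ hi, traceOperator_apply, traceOperator_apply, map_sum]
  exact Finset.sum_congr rfl fun g _ => by rw [map_smul, hf g g.2]

/-- The subspace spanned by the images of all intertwiners from ψ is its isotypic component; the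
trace operator maps into it. -/
lemma traceOperator_mem_of_forall [FiniteDimensional ℂ W] {α : G → G → ℂˣ} {K : Subgroup G}
    [Fintype K] {ψ : G → W ≃ₗ[ℂ] W} {φ : G → V ≃ₗ[ℂ] V} (hψ : IsTwistedOn α K ψ)
    (hφ : IsTwistedOn α K φ) {X : Submodule ℂ V} (hX : ∀ f ∈ homOn K ψ φ, ∀ w, f w ∈ X)
    (B : W →ₗ[ℂ] W) (v : V) : traceOperator K ψ φ B v ∈ X := by
  rw [traceOperator_eq_sum_averageOn (finBasis ℂ W)]
  exact Submodule.sum_mem _ fun i _ => hX _ (averageOn_mem_homOn hψ hφ _) _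

lemma traceOperator_eq_zero [FiniteDimensional ℂ W] {α : G → G → ℂˣ} {K : Subgroup G}
    [Fintype K] {ψ : G → W ≃ₗ[ℂ] W} {φ : G → V ≃ₗ[ℂ] V} (hψ : IsTwistedOn α K ψ)
    (hφ : IsTwistedOn α K φ) (h : homOn K ψ φ = ⊥) (B : W →ₗ[ℂ] W) :
    traceOperator K ψ φ B = 0 := by
  ext v
  refine (Submodule.mem_bot ℂ).1 (traceOperator_mem_of_forall hψ hφ (fun f hf w => ?_) B v)
  rw [h, Submodule.mem_bot] at hf
  simp [hf]

lemma IsTwistedOn.one_apply {α : G → G → ℂˣ} {K : Subgroup G} {φ : G → V ≃ₗ[ℂ] V}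
    (hφ : IsTwistedOn α K φ) (v : V) : φ 1 v = (α 1 1 : ℂ) • v := by
  have h := hφ 1 K.one_mem 1 K.one_mem v
  rw [mul_one, ← map_smul] at h
  exact (φ 1).injective h

end TwistedRepresentations

/-! ### Complete reducibility and existence of irreducible representations -/

section Existence

variable {G : Type*} [Group G] {V W : Type*}
  [AddCommGroup V] [Module ℂ V] [AddCommGroup W] [Module ℂ W]

lemma exists_restrict [FiniteDimensional ℂ V] {K : Subgroup G} {φ : G → V ≃ₗ[ℂ] V}
    {X : Submodule ℂ V} (hX : ∀ g ∈ K, ∀ v ∈ X, φ g v ∈ X) :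
    ∃ ψ : G → X ≃ₗ[ℂ] X, X.subtype ∈ homOn K ψ φ := by
  classical
  -- Nothing is required off `K`, so the identity serves there as a default value.
  refine ⟨fun g => if h : g ∈ K then LinearEquiv.ofInjectiveEndo
    ((φ g).toLinearMap.restrict (hX g h)) (fun v w hvw => ?_) else 1, fun g hg v => ?_⟩
  · exact Subtype.ext ((φ g).injective (congrArg Subtype.val hvw))
  · simp only [dif_pos hg]
    rfl

lemma IsTwistedOn.of_injective_hom {α : G → G → ℂˣ} {K : Subgroup G} {ψ : G → W ≃ₗ[ℂ] W}
    {φ : G → V ≃ₗ[ℂ] V} (hφ : IsTwistedOn α K φ) {f : W →ₗ[ℂ] V} (hf : f ∈ homOn K ψ φ)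
    (hi : Function.Injective f) : IsTwistedOn α K ψ := by
  intro x hx y hy w
  apply hi
  rw [hf x hx, hf y hy, hφ x hx y hy, map_smul, hf _ (K.mul_mem hx hy)]

/-- Maschke's theorem. -/
lemma exists_isCompl_invariant {α : G → G → ℂˣ} {K : Subgroup G} [Finite K]
    {φ : G → V ≃ₗ[ℂ] V} (hφ : IsTwistedOn α K φ) {X : Submodule ℂ V}
    (hX : ∀ g ∈ K, ∀ v ∈ X, φ g v ∈ X) :
    ∃ Y : Submodule ℂ V, (∀ g ∈ K, ∀ v ∈ Y, φ g v ∈ Y) ∧ IsCompl X Y := by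
  have := Fintype.ofFinite K
  obtain ⟨p, hp⟩ := LinearMap.exists_leftInverse_of_injective X.subtype X.ker_subtype
  have hp' : ∀ v : X, p v = v := fun v => LinearMap.congr_fun hp v
  have h0 : (Nat.card K : ℂ) ≠ 0 := Nat.cast_ne_zero.2 Nat.card_pos.ne'
  have hsymm : ∀ g ∈ K, ∀ v ∈ X, (φ g).symm v ∈ X := fun g hg v hv => by
    have h1 : (φ g).symm v = (α g⁻¹ g * α 1 1 : ℂˣ)⁻¹ • φ g⁻¹ v := by
      rw [LinearEquiv.symm_apply_eq, eq_comm]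
      have h2 := hφ g⁻¹ (K.inv_mem hg) g hg ((φ g).symm v)
      rw [LinearEquiv.apply_symm_apply, inv_mul_cancel, hφ.one_apply] at h2
      rw [h2, Units.smul_def, map_smul, map_smul, map_smul, LinearEquiv.apply_symm_apply]
      rw [smul_smul, smul_smul, ← Units.val_mul, ← Units.val_mul, mul_assoc, inv_mul_cancel]
      simp
    rw [h1]
    exact X.smul_mem _ (hX _ (K.inv_mem hg) _ hv)
  -- The average of a linear projection onto `X`, not divided by |K|: on `X` it is multiplication by
  -- |K|, and its kernel is the complement.
  set P := averageOn K φ φ (X.subtype ∘ₗ p) with hP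
  have hPm : P ∈ homOn K φ φ := averageOn_mem_homOn hφ hφ _
  have hPX : ∀ v ∈ X, P v = (Nat.card K : ℂ) • v := fun v hv => by
    rw [hP, averageOn_apply]
    have : ∀ g : K, φ g ((X.subtype ∘ₗ p) ((φ g).symm v)) = v := fun g => by
      have h1 : (X.subtype ∘ₗ p) ((φ g).symm v) = (φ g).symm v :=
        congrArg Subtype.val (hp' ⟨_, hsymm g g.2 v hv⟩)
      rw [h1, LinearEquiv.apply_symm_apply]
    rw [Finset.sum_congr rfl fun g _ => this g]
    simp [Nat.cast_smul_eq_nsmul]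
  have hPr : ∀ v, P v ∈ X := fun v => by
    rw [hP, averageOn_apply]
    exact X.sum_mem fun g _ => hX g g.2 _ (Submodule.coe_mem _)
  refine ⟨LinearMap.ker P, fun g hg v hv => ?_, ?_, ?_⟩
  · rw [LinearMap.mem_ker] at hv ⊢
    rw [hPm g hg, hv, map_zero]
  · rw [Submodule.disjoint_def]
    intro v hv hv'
    rw [LinearMap.mem_ker, hPX v hv] at hv'
    exact (smul_eq_zero.1 hv').resolve_left h0
  · rw [codisjoint_iff, eq_top_iff]
    intro v _
    refine Submodule.mem_sup.2 ⟨(Nat.card K : ℂ)⁻¹ • P v, X.smul_mem _ (hPr v),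
      v - (Nat.card K : ℂ)⁻¹ • P v, ?_, by abel⟩
    rw [LinearMap.mem_ker, map_sub, map_smul, hPX _ (hPr v), smul_smul, inv_mul_cancel₀ h0,
      one_smul, sub_self]

/-- A nonzero linear map does not vanish on some irreducible subrepresentation. -/
lemma exists_irreducible_submodule [FiniteDimensional ℂ V] {α : G → G → ℂˣ} {K : Subgroup G}
    [Finite K] {φ : G → V ≃ₗ[ℂ] V} (hφ : IsTwistedOn α K φ) {A : V →ₗ[ℂ] W} (hA : A ≠ 0) :
    ∃ (X : Submodule ℂ V) (ψ : G → X ≃ₗ[ℂ] X), X.subtype ∈ homOn K ψ φ ∧ IsTwistedOn α K ψ ∧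
      IsIrreducibleOn K ψ ∧ ∃ v ∈ X, A v ≠ 0 := by
  -- A minimal member is irreducible: if it split into two proper invariant summands, `A` would
  -- vanish on each of them by minimality, hence on their sum.
  let S : Set (Submodule ℂ V) := {X | (∀ g ∈ K, ∀ v ∈ X, φ g v ∈ X) ∧ ∃ v ∈ X, A v ≠ 0}
  have hS : S.Nonempty := by
    refine ⟨⊤, fun _ _ _ _ => Submodule.mem_top, ?_⟩
    by_contra! h
    exact hA (LinearMap.ext fun v => h v Submodule.mem_top)
  obtain ⟨X, ⟨hX, v, hv, hAv⟩, hmin⟩ :=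
    WellFounded.has_min (wellFounded_lt (α := Submodule ℂ V)) S hS
  obtain ⟨ψ, hψ⟩ := exists_restrict hX
  refine ⟨X, ψ, hψ, hφ.of_injective_hom hψ X.injective_subtype,
    ⟨⟨⟨v, hv⟩, 0, ?_⟩, fun Y hY => ?_⟩, v, hv, hAv⟩
  · rintro h
    apply hAv
    rw [show v = 0 from congrArg Subtype.val h, map_zero]
  · have hY' : ∀ g ∈ K, ∀ v ∈ Y.map X.subtype, φ g v ∈ Y.map X.subtype := by
      rintro g hg _ ⟨y, hy, rfl⟩
      exact ⟨ψ g y, hY g hg y hy, hψ g hg y⟩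
    obtain ⟨Z, hZ, hYZ⟩ := exists_isCompl_invariant hφ hY'
    have hle : Y.map X.subtype ≤ X := Submodule.map_subtype_le X Y
    have hsup : Y.map X.subtype ⊔ (Z ⊓ X) = X := by
      rw [← sup_inf_assoc_of_le Z hle, hYZ.sup_eq_top, top_inf_eq]
    by_cases h1 : Y.map X.subtype = X
    · right
      rw [eq_top_iff]
      rintro y -
      obtain ⟨y', hy', h⟩ := h1.symm.le y.2
      rwa [← Subtype.ext h]
    by_cases h2 : Z ⊓ X = X
    · left
      have h3 : Y.map X.subtype = ⊥ := by
        rw [eq_bot_iff, ← hYZ.inf_eq_bot]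
        exact le_inf le_rfl (hle.trans (inf_eq_right.1 h2))
      exact Submodule.map_injective_of_injective X.injective_subtype
        (h3.trans (Submodule.map_bot _).symm)
    exfalso
    have k1 : ∀ v ∈ Y.map X.subtype, A v = 0 := by
      by_contra! h
      exact hmin _ ⟨hY', h⟩ (lt_of_le_of_ne hle h1)
    have k2 : ∀ v ∈ Z ⊓ X, A v = 0 := by
      by_contra! h
      exact hmin _ ⟨fun g hg v hv => Submodule.mem_inf.2
        ⟨hZ g hg v hv.1, hX g hg v hv.2⟩, h⟩
        (lt_of_le_of_ne inf_le_right h2)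
    rw [← hsup] at hv
    obtain ⟨a, ha, b, hb, rfl⟩ := Submodule.mem_sup.1 hv
    exact hAv (by rw [map_add, k1 a ha, k2 b hb, add_zero])

/-- The right regular representation of `K`, on functions. -/
noncomputable def regularRep (α : Z2 G) (K : Subgroup G) (g : K) : (K → ℂ) ≃ₗ[ℂ] (K → ℂ) where
  toFun v k := α.1 k g * v (k * g)
  map_add' v w := by ext k; simp [mul_add]
  map_smul' c v := by ext k; simp [mul_left_comm]
  invFun v k := (α.1 (k * g⁻¹) g : ℂ)⁻¹ * v (k * g⁻¹)
  left_inv v := by ext k; simp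
  right_inv v := by ext k; simp

/-- An element of the twisted group algebra that acts as zero in all irreducible representations is
zero. -/
lemma exists_irreducible_sum_ne_zero (α : Z2 G) (K : Subgroup G) [Fintype K] {a : G → ℂ} {x : G}
    (hx : x ∈ K) (ha : a x ≠ 0) :
    ∃ (V : Type) (_ : AddCommGroup V) (_ : Module ℂ V) (_ : FiniteDimensional ℂ V)
      (φ : G → V ≃ₗ[ℂ] V), IsTwistedOn α.1 K φ ∧ IsIrreducibleOn K φ ∧
        ∃ v, ∑ g : K, a g • φ g v ≠ 0 := by
  classical
  -- The regular representation is moved to a coordinate space because `V` must lie in `Type`, while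
  -- `K` lives in the universe of `G`.
  let e : (K → ℂ) ≃ₗ[ℂ] (Fin (Fintype.card K) → ℂ) :=
    LinearEquiv.funCongrLeft ℂ ℂ (Fintype.equivFin K).symm
  let φ : G → (Fin (Fintype.card K) → ℂ) ≃ₗ[ℂ] (Fin (Fintype.card K) → ℂ) := fun g =>
    if h : g ∈ K then e.symm ≪≫ₗ regularRep α K ⟨g, h⟩ ≪≫ₗ e else 1
  have hφe : ∀ (g : K) v, φ g (e v) = e (regularRep α K g v) := fun g v => by
    simp [φ]
  have hφ : IsTwistedOn α.1 K φ := by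
    intro x hx y hy v
    obtain ⟨v, rfl⟩ := e.surjective v
    rw [hφe ⟨y, hy⟩, hφe ⟨x, hx⟩,
      show x * y = ((⟨x, hx⟩ * ⟨y, hy⟩ : K) : G) from rfl, hφe, ← map_smul]
    congr 1
    ext k
    have h := congrArg Units.val (α.2 k x y)
    simp only [Units.val_mul] at h
    simp only [regularRep, LinearEquiv.coe_mk, LinearMap.coe_mk, AddHom.coe_mk, Pi.smul_apply,
      smul_eq_mul, Subgroup.coe_mul, ← mul_assoc]
    rw [h]
    ring
  obtain ⟨X, ψ, hX, hψ, hi, v, hv, hne⟩ := exists_irreducible_submodule hφ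
    (A := ∑ g : K, a g • (φ g).toLinearMap) (by
      intro h0
      -- Applied to the delta function at x and read at 1, the regular representation leaves the
      -- single term a(x) α(1, x).
      have h1 := LinearMap.congr_fun h0 (e (Pi.single ⟨x, hx⟩ 1))
      simp only [LinearMap.sum_apply, LinearMap.smul_apply, LinearEquiv.coe_coe, hφe,
        ← map_smul, ← map_sum, LinearMap.zero_apply, LinearEquiv.map_eq_zero_iff] at h1
      have h2 := congrFun h1 1
      simp only [regularRep, LinearEquiv.coe_mk, LinearMap.coe_mk, AddHom.coe_mk, Pi.smul_apply,
        Finset.sum_apply, smul_eq_mul, one_mul, Pi.zero_apply, Pi.single_apply] at h2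
      simp [ha] at h2)
  refine ⟨X, inferInstance, inferInstance, inferInstance, ψ, hψ, hi, ⟨v, hv⟩, fun h => hne ?_⟩
  have h1 := congrArg X.subtype h
  rw [map_sum, map_zero] at h1
  rw [LinearMap.sum_apply, ← h1]
  refine Finset.sum_congr rfl fun g _ => ?_
  rw [map_smul, hX g g.2]
  rfl

lemma sum_ite_mem_subgroup {G V : Type*} [Group G] [AddCommMonoid V] {M L : Subgroup G}
    [Fintype M] [Fintype L] (h : M ≤ L)
    [DecidablePred (· ∈ M)] (F : G → V) :
    ∑ g : L, (if (g : G) ∈ M then F g else 0) = ∑ g : M, F g := by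
  symm
  refine Fintype.sum_of_injective (Subgroup.inclusion h) (Subgroup.inclusion_injective h) _ _
    (fun g hg => if_neg fun hM => hg ⟨⟨g, hM⟩, rfl⟩) fun g => ?_
  simp

lemma trace_symm_one_ne_zero [FiniteDimensional ℂ W] {α : G → G → ℂˣ} {K : Subgroup G}
    {ψ : G → W ≃ₗ[ℂ] W} (hψ : IsTwistedOn α K ψ) (hi : IsIrreducibleOn K ψ) :
    LinearMap.trace ℂ W (ψ 1).symm.toLinearMap ≠ 0 := by
  have := hi.1
  have h : (ψ 1).symm.toLinearMap = ((α 1 1)⁻¹ : ℂˣ).val • (1 : W →ₗ[ℂ] W) := by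
    ext w
    change (ψ 1).symm w = ((α 1 1)⁻¹ : ℂˣ).val • w
    rw [LinearEquiv.symm_apply_eq, map_smul, hψ.one_apply, smul_smul]
    simp
  rw [h, map_smul, LinearMap.trace_one, smul_eq_mul]
  exact mul_ne_zero (Units.ne_zero _) (Nat.cast_ne_zero.2 finrank_pos.ne')

/-- Every irreducible representation of a subgroup occurs in an irreducible representation. -/
lemma exists_irreducible_over [FiniteDimensional ℂ W] (α : Z2 G) {M L : Subgroup G} [Finite L]
    (hML : M ≤ L) {ψ : G → W ≃ₗ[ℂ] W} (hψ : IsTwistedOn α.1 M ψ) (hi : IsIrreducibleOn M ψ) :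
    ∃ (V : Type) (_ : AddCommGroup V) (_ : Module ℂ V) (_ : FiniteDimensional ℂ V)
      (φ : G → V ≃ₗ[ℂ] V), IsTwistedOn α.1 L φ ∧ IsIrreducibleOn L φ ∧ homOn M ψ φ ≠ ⊥ := by
  classical
  have := Fintype.ofFinite L
  have : Finite M := Finite.of_injective _ (Subgroup.inclusion_injective hML)
  have := Fintype.ofFinite M
  -- The coefficients are the traces of `(ψ g).symm`, extended by zero from M to L. On a
  -- representation of L without ψ as a constituent, this element acts as zero.
  obtain ⟨V, _, _, _, φ, hφ, hφi, v, hv⟩ := exists_irreducible_sum_ne_zero α L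
    (a := fun g => if g ∈ M then LinearMap.trace ℂ W (ψ g).symm.toLinearMap else 0)
    (x := 1) L.one_mem (by
      simp only [M.one_mem, if_true]
      exact trace_symm_one_ne_zero hψ hi)
  refine ⟨V, _, _, ‹_›, φ, hφ, hφi, fun h => hv ?_⟩
  simp only [ite_smul, zero_smul]
  rw [sum_ite_mem_subgroup hML (fun g => LinearMap.trace ℂ W (ψ g).symm.toLinearMap • φ g v)]
  exact (traceOperator_apply M ψ φ 1 v).symm.trans
    (LinearMap.congr_fun (traceOperator_eq_zero hψ (hφ.mono hML) h 1) v)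

end Existence

/-! ### Degrees of irreducible projective representations divide the group order -/

section Degree

variable {G : Type*} [Group G] {U V W : Type*} [AddCommGroup U] [Module ℂ U]
  [AddCommGroup V] [Module ℂ V] [AddCommGroup W] [Module ℂ W]

lemma isIntegral_trace_of_pow_eq_one [FiniteDimensional ℂ V] {f : Module.End ℂ V} {n : ℕ}
    (hn : 0 < n) (hf : f ^ n = 1) : IsIntegral ℤ (LinearMap.trace ℂ V f) := by
  rw [Module.End.trace_eq_sum_roots_charpoly_of_splits (IsAlgClosed.splits _)]
  refine IsIntegral.multiset_sum fun μ hμ => ?_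
  have h := (Module.End.hasEigenvalue_iff_isRoot_charpoly f μ).2 (Polynomial.isRoot_of_mem_roots hμ)
  obtain ⟨v, hv⟩ := h.exists_hasEigenvector
  have h1 := hv.pow_apply n
  rw [hf, Module.End.one_apply] at h1
  have h2 : (1 - μ ^ n) • v = 0 := by rw [sub_smul, ← h1, one_smul, sub_self]
  have h3 : μ ^ n = 1 := (sub_eq_zero.1 ((smul_eq_zero.1 h2).resolve_right hv.2)).symm
  exact IsIntegral.of_pow hn (h3 ▸ isIntegral_one)

lemma nat_dvd_of_isIntegral_div {m n : ℕ} (hn : n ≠ 0) (h : IsIntegral ℤ ((m : ℂ) / n)) :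
    n ∣ m := by
  have h1 : ((m : ℂ) / n) = algebraMap ℚ ℂ ((m : ℚ) / n) := by simp
  rw [h1, isIntegral_algebraMap_iff (algebraMap ℚ ℂ).injective,
    IsIntegrallyClosed.isIntegral_iff] at h
  obtain ⟨z, hz⟩ := h
  have h2 : (z : ℚ) * n = m := by
    rw [show (z : ℚ) = m / n from hz]
    field_simp
  exact Int.natCast_dvd_natCast.1 ⟨z, by rw [mul_comm]; exact_mod_cast h2.symm⟩

/-- With cocycle values roots of unity, every φ(x) has finite order and integral trace. The identity
∑ tr(φ(g)⁻¹) φ(g) = |G| / dim V then shows that |G| / dim V preserves a nonzero finitely generated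
module over the algebraic integers, spanned by values of one matrix coefficient; so it is an
integer. -/
lemma finrank_dvd_card_of_pow_eq_one [Finite G] [FiniteDimensional ℂ V] {α : G → G → ℂˣ}
    {φ : G → V ≃ₗ[ℂ] V} (hφ : IsTwistedOn α ⊤ φ) (hi : IsIrreducibleOn ⊤ φ) {n : ℕ} (hn : 0 < n)
    (hα : ∀ x y, α x y ^ n = 1) : finrank ℂ V ∣ Nat.card G := by
  have := hi.1
  have := Fintype.ofFinite (⊤ : Subgroup G)
  have hpow : ∀ (x : G) (k : ℕ), ∃ c : ℂˣ, c ^ n = 1 ∧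
      ∀ v, ((φ x).toLinearMap ^ k : Module.End ℂ V) v = (c : ℂ) • φ (x ^ k) v := by
    intro x k
    induction k with
    | zero =>
      refine ⟨(α 1 1)⁻¹, by rw [inv_pow, hα, inv_one], fun v => ?_⟩
      rw [pow_zero, pow_zero, hφ.one_apply, smul_smul]
      simp
    | succ k ih =>
      obtain ⟨c, hc, h⟩ := ih
      refine ⟨c * α x (x ^ k), by rw [mul_pow, hc, hα, one_mul], fun v => ?_⟩
      rw [pow_succ', Module.End.mul_apply, h, map_smul]
      change (c : ℂ) • φ x (φ (x ^ k) v) = _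
      rw [hφ x trivial _ trivial, smul_smul, pow_succ', Units.val_mul]
  have hint : ∀ x, IsIntegral ℤ (LinearMap.trace ℂ V (φ x).symm.toLinearMap) := by
    intro x
    obtain ⟨c, hc, h⟩ := hpow x (Nat.card G)
    have h1 : ((φ x).toLinearMap ^ Nat.card G : Module.End ℂ V) = ((c * α 1 1 : ℂˣ) : ℂ) • 1 := by
      ext v
      rw [h, pow_card_eq_one', hφ.one_apply, smul_smul]
      simp
    have h2 : ((φ x).toLinearMap ^ (Nat.card G * n) : Module.End ℂ V) = 1 := by
      rw [pow_mul, h1, smul_pow, one_pow, ← Units.val_pow_eq_pow_val, mul_pow, hc, hα]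
      simp
    refine isIntegral_trace_of_pow_eq_one (n := Nat.card G * n) (Nat.mul_pos Nat.card_pos hn) ?_
    have h3 : ((φ x).symm.toLinearMap : Module.End ℂ V) * (φ x).toLinearMap = 1 := by
      ext v
      simp
    have h4 : Commute ((φ x).symm.toLinearMap : Module.End ℂ V) (φ x).toLinearMap := by
      ext v
      simp
    rw [← mul_one ((φ x).symm.toLinearMap ^ (Nat.card G * n) : Module.End ℂ V), ← h2,
      ← h4.mul_pow, h3, one_pow, h2]
  let R := integralClosure ℤ ℂ
  have hαint : ∀ x y, IsIntegral ℤ (α x y : ℂ) := fun x y =>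
    IsIntegral.of_pow hn (by
      rw [← Units.val_pow_eq_pow_val, hα]
      exact isIntegral_one)
  obtain ⟨u, hu⟩ := exists_ne (0 : V)
  obtain ⟨l, hl, -⟩ := Submodule.exists_le_ker_of_notMem (p := (⊥ : Submodule ℂ V)) (v := φ 1 u)
    (by simpa using hu)
  let N : Submodule R ℂ := Submodule.span R (Set.range fun h => l (φ h u))
  have hN : N ≠ ⊥ := fun h => hl ((Submodule.mem_bot R).1 (h ▸ Submodule.subset_span ⟨1, rfl⟩))
  have hfg : N.FG := Submodule.fg_span (Set.finite_range _)
  have hsmul : ∀ z ∈ N, ((Nat.card (⊤ : Subgroup G) : ℂ) / finrank ℂ V) • z ∈ N := by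
    intro z hz
    induction hz using Submodule.span_induction with
    | mem z hz =>
      obtain ⟨h, rfl⟩ := hz
      change _ • l (φ h u) ∈ N
      have h1 := traceOperator_self hφ hi 1 (φ h u)
      rw [Module.End.one_apply] at h1
      rw [← map_smul, ← h1, traceOperator_apply, map_sum]
      refine N.sum_mem fun g _ => ?_
      rw [hφ g trivial h trivial, map_smul, map_smul, smul_smul]
      exact N.smul_mem (⟨_, (hint g).mul (hαint g h)⟩ : R)
        (Submodule.subset_span ⟨(g : G) * h, rfl⟩)
    | zero => simp
    | add x y _ _ hx hy => rw [smul_add]; exact N.add_mem hx hy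
    | smul a x _ hx => rw [smul_comm]; exact N.smul_mem a hx
  have h1 := isIntegral_of_smul_mem_submodule N hN hfg _ hsmul
  have h2 : IsIntegral ℤ ((Nat.card (⊤ : Subgroup G) : ℂ) / finrank ℂ V) := isIntegral_trans _ h1
  have h3 := nat_dvd_of_isIntegral_div finrank_pos.ne' h2
  rwa [Subgroup.card_top] at h3

lemma det_eq_pow_of_forall_apply_eq_smul [FiniteDimensional ℂ V] {f g : V →ₗ[ℂ] V} {c : ℂ}
    (h : ∀ v, f v = c • g v) :
    LinearMap.det f = c ^ finrank ℂ V * LinearMap.det g := by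
  rw [show f = c • g from LinearMap.ext h, LinearMap.det_smul]

/-- The degree of an irreducible projective representation divides the order of the group. -/
lemma finrank_dvd_card [Finite G] [FiniteDimensional ℂ V]
    {φ : G → V ≃ₗ[ℂ] V} (hφ : ∀ x y, ∃ c : ℂˣ, ∀ v, φ x (φ y v) = (c : ℂ) • φ (x * y) v)
    (hi : IsIrreducibleOn ⊤ φ) : finrank ℂ V ∣ Nat.card G := by
  have := hi.1
  have hn : 0 < finrank ℂ V := finrank_pos
  have hdet : ∀ x, LinearMap.det (φ x).toLinearMap ≠ 0 := fun x =>
    (LinearEquiv.isUnit_det' _).ne_zero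
  -- Rescaling every operator to determinant 1 makes the cocycle values roots of unity of order
  -- dividing dim V.
  have hroot : ∀ x, ∃ c : ℂ, c ^ finrank ℂ V = (LinearMap.det (φ x).toLinearMap)⁻¹ := fun x =>
    IsAlgClosed.exists_pow_nat_eq _ hn
  choose c hc using hroot
  have hc0 : ∀ x, c x ≠ 0 := by
    intro x h
    have h1 := hc x
    rw [h, zero_pow hn.ne'] at h1
    exact inv_ne_zero (hdet x) h1.symm
  let φ' : G → V ≃ₗ[ℂ] V := fun x => φ x ≪≫ₗ LinearEquiv.smulOfNeZero ℂ V (c x) (hc0 x)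
  have hφ' : ∀ x v, φ' x v = c x • φ x v := fun x v => rfl
  have hdet' : ∀ x, LinearMap.det (φ' x).toLinearMap = 1 := fun x => by
    rw [det_eq_pow_of_forall_apply_eq_smul (hφ' x), hc, inv_mul_cancel₀ (hdet x)]
  have hproj : ∀ x y, ∃ a : ℂˣ, ∀ v, φ' x (φ' y v) = (a : ℂ) • φ' (x * y) v := by
    intro x y
    obtain ⟨a, ha⟩ := hφ x y
    refine ⟨Units.mk0 (c x) (hc0 x) * Units.mk0 (c y) (hc0 y) * a *
      (Units.mk0 (c (x * y)) (hc0 _))⁻¹, fun v => ?_⟩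
    rw [hφ', hφ', hφ', map_smul, ha, smul_smul, smul_smul, smul_smul]
    congr 1
    have := hc0 (x * y)
    push_cast
    rw [Units.val_mk0, Units.val_mk0, Units.val_mk0]
    field_simp
  choose α hα using hproj
  refine finrank_dvd_card_of_pow_eq_one (α := α) (φ := φ') (n := finrank ℂ V)
    (fun x _ y _ => hα x y) ⟨hi.1, fun X hX => hi.2 X fun x hx v hv => ?_⟩ hn fun x y => ?_
  · have h1 := X.smul_mem (c x)⁻¹ (hX x hx v hv)
    rwa [hφ', smul_smul, inv_mul_cancel₀ (hc0 x), one_smul] at h1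
  · have h1 := det_eq_pow_of_forall_apply_eq_smul
      (f := (φ' x).toLinearMap ∘ₗ (φ' y).toLinearMap) (g := (φ' (x * y)).toLinearMap) (hα x y)
    rw [LinearMap.det_comp, hdet', hdet', hdet', mul_one, mul_one] at h1
    exact Units.ext (by rw [Units.val_pow_eq_pow_val, ← h1, Units.val_one])

/-- The degree of an irreducible projective representation divides the index of a normal subgroup
that acts by scalars. -/
lemma finrank_dvd_index [Finite G] [FiniteDimensional ℂ V] (M : Subgroup G) [M.Normal]
    {φ : G → V ≃ₗ[ℂ] V} (hφ : ∀ x y, ∃ c : ℂˣ, ∀ v, φ x (φ y v) = (c : ℂ) • φ (x * y) v)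
    (hM : ∀ x ∈ M, ∃ c : ℂˣ, ∀ v, φ x v = (c : ℂ) • v)
    (hi : IsIrreducibleOn ⊤ φ) : finrank ℂ V ∣ M.index := by
  have key : ∀ x y : G, (x : G ⧸ M) = y → ∃ c : ℂˣ, ∀ v, φ x v = (c : ℂ) • φ y v := by
    intro x y h
    obtain ⟨c, hc⟩ := hM _ (QuotientGroup.eq.1 h.symm)
    obtain ⟨d, hd⟩ := hφ y (y⁻¹ * x)
    refine ⟨d⁻¹ * c, fun v => ?_⟩
    have h1 := hd v
    rw [hc, map_smul, mul_inv_cancel_left] at h1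
    rw [Units.val_mul, mul_smul, h1, smul_smul]
    simp
  rw [Subgroup.index_eq_card]
  refine finrank_dvd_card (φ := fun q : G ⧸ M => φ q.out) (fun p q => ?_)
    ⟨hi.1, fun X hX => hi.2 X fun x _ v hv => ?_⟩
  · obtain ⟨c, hc⟩ := hφ p.out q.out
    obtain ⟨d, hd⟩ := key (p.out * q.out) (p * q : G ⧸ M).out (by simp)
    exact ⟨c * d, fun v => by rw [hc, hd, smul_smul, Units.val_mul]⟩
  · obtain ⟨c, hc⟩ := key x (x : G ⧸ M).out (by simp)
    rw [hc]
    exact X.smul_mem _ (hX _ trivial v hv)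

end Degree

/-! ### Conjugate representations, stabilizers and isotypic projections -/

section Clifford

variable {G : Type*} [Group G] {U V W : Type*} [AddCommGroup U] [Module ℂ U]
  [AddCommGroup V] [Module ℂ V] [AddCommGroup W] [Module ℂ W]

/-- Conjugation by gσ is an automorphism of the twisted group algebra. -/
lemma conjScalar_mul_left (α : Z2 G) (x y g : G) :
    conjScalar α x g * conjScalar α y g * α.1 (g⁻¹ * x * g) (g⁻¹ * y * g)
      = α.1 x y * conjScalar α (x * y) g := by
  have h1 := α.2 x y g
  have h2 := α.2 x g (g⁻¹ * y * g)
  have h3 := α.2 g (g⁻¹ * x * g) (g⁻¹ * y * g)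
  have e1 : g * (g⁻¹ * y * g) = y * g := by group
  have e2 : g * (g⁻¹ * x * g) = x * g := by group
  have e3 : g⁻¹ * x * g * (g⁻¹ * y * g) = g⁻¹ * (x * y) * g := by group
  rw [e1] at h2
  rw [e2, e3] at h3
  unfold conjScalar
  rw [← mul_assoc (α.1 x y), h1, eq_mul_inv_of_mul_eq h2.symm, eq_inv_mul_of_mul_eq h3.symm]
  apply Units.ext
  push_cast
  field_simp

/-- Conjugating by gσ and then by hσ is conjugating by (gh)σ, since the scalar α(g, h) between them
is central. -/
lemma conjScalar_mul_right (α : Z2 G) (x g h : G) :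
    conjScalar α x (g * h) = conjScalar α x g * conjScalar α (g⁻¹ * x * g) h := by
  have h1 := α.2 x g h
  have h2 := α.2 g (g⁻¹ * x * g) h
  have h3 := α.2 g h (h⁻¹ * (g⁻¹ * x * g) * h)
  have e1 : g * (g⁻¹ * x * g) = x * g := by group
  have e2 : h * (h⁻¹ * (g⁻¹ * x * g) * h) = g⁻¹ * x * g * h := by group
  have e3 : (g * h)⁻¹ * x * (g * h) = h⁻¹ * (g⁻¹ * x * g) * h := by group
  rw [e1] at h2
  rw [e2] at h3
  unfold conjScalar
  rw [e3, eq_mul_inv_of_mul_eq h1.symm, eq_inv_mul_of_mul_eq h3, eq_inv_mul_of_mul_eq h2.symm]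
  apply Units.ext
  push_cast
  field_simp

lemma conjScalar_one_right (α : Z2 G) (x : G) : conjScalar α x 1 = 1 := by
  have h := conjScalar_mul_right α x 1 1
  simpa using h

lemma IsTwistedOn.apply_apply_conj {α : Z2 G} {K : Subgroup G} {φ : G → V ≃ₗ[ℂ] V}
    (hφ : IsTwistedOn α.1 K φ) {x g : G} (hx : x ∈ K) (hg : g ∈ K) (v : V) :
    φ x (φ g v) = (conjScalar α x g : ℂ) • φ g (φ (g⁻¹ * x * g) v) := by
  rw [hφ x hx g hg, hφ g hg _ (K.mul_mem (K.mul_mem (K.inv_mem hg) hx) hg), smul_smul,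
    conjScalar, show g * (g⁻¹ * x * g) = x * g by group]
  simp

/-- The conjugate of the representation `ψ` by `g`. -/
noncomputable def conjRep (α : Z2 G) (ψ : G → W ≃ₗ[ℂ] W) (g x : G) : W ≃ₗ[ℂ] W :=
  ψ (g⁻¹ * x * g) ≪≫ₗ LinearEquiv.smulOfNeZero ℂ W (conjScalar α x g : ℂ) (Units.ne_zero _)

lemma conjRep_apply (α : Z2 G) (ψ : G → W ≃ₗ[ℂ] W) (g x : G) (w : W) :
    conjRep α ψ g x w = (conjScalar α x g : ℂ) • ψ (g⁻¹ * x * g) w := rfl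

lemma conjRep_symm_apply (α : Z2 G) (ψ : G → W ≃ₗ[ℂ] W) (g x : G) (w : W) :
    (conjRep α ψ g x).symm w = (conjScalar α x g : ℂ)⁻¹ • (ψ (g⁻¹ * x * g)).symm w := by
  rw [LinearEquiv.symm_apply_eq, conjRep_apply, map_smul, LinearEquiv.apply_symm_apply, smul_smul,
    mul_inv_cancel₀ (Units.ne_zero _), one_smul]

lemma conjRep_conjRep_apply (α : Z2 G) (ψ : G → W ≃ₗ[ℂ] W) (g h x : G) (w : W) :
    conjRep α (conjRep α ψ h) g x w = conjRep α ψ (g * h) x w := by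
  rw [conjRep_apply, conjRep_apply, conjRep_apply, conjScalar_mul_right, smul_smul, Units.val_mul]
  congr 3
  group

variable {M L : Subgroup G} [M.Normal]

lemma inv_mul_mul_mem {x : G} (hx : x ∈ M) (g : G) : g⁻¹ * x * g ∈ M := by
  simpa using Subgroup.Normal.conj_mem ‹M.Normal› x hx g⁻¹

lemma IsTwistedOn.conjRep {α : Z2 G} {ψ : G → W ≃ₗ[ℂ] W}
    (hψ : IsTwistedOn α.1 M ψ) (g : G) : IsTwistedOn α.1 M (conjRep α ψ g) := by
  intro x hx y hy w
  rw [conjRep_apply, conjRep_apply, conjRep_apply, map_smul,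
    hψ _ (inv_mul_mul_mem hx g) _ (inv_mul_mul_mem hy g), smul_smul, smul_smul, smul_smul,
    ← Units.val_mul, ← Units.val_mul, ← Units.val_mul, conjScalar_mul_left]
  congr 3
  group

lemma IsIrreducibleOn.conjRep {α : Z2 G} {ψ : G → W ≃ₗ[ℂ] W}
    (hψ : IsIrreducibleOn M ψ) (g : G) : IsIrreducibleOn M (conjRep α ψ g) := by
  refine ⟨hψ.1, fun X hX => hψ.2 X fun x hx v hv => ?_⟩
  have h1 := hX (g * x * g⁻¹) (Subgroup.Normal.conj_mem ‹_› x hx g) v hv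
  rw [conjRep_apply, show g⁻¹ * (g * x * g⁻¹) * g = x by group] at h1
  exact (X.smul_mem_iff (Units.ne_zero _)).1 h1

lemma trans_mem_homOn_conjRep {α : Z2 G} {ψ : G → W ≃ₗ[ℂ] W} {g h : G} {y z : W ≃ₗ[ℂ] W}
    (hy : y.toLinearMap ∈ homOn M (conjRep α ψ g) ψ)
    (hz : z.toLinearMap ∈ homOn M (conjRep α ψ h) ψ) :
    (z ≪≫ₗ y).toLinearMap ∈ homOn M (conjRep α ψ (g * h)) ψ := by
  intro x hx w
  have h1 := hz _ (inv_mul_mul_mem hx g) w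
  have h2 := hy _ hx (z w)
  simp only [LinearEquiv.coe_coe, LinearEquiv.trans_apply] at h1 h2 ⊢
  rw [← h2, ← conjRep_conjRep_apply, conjRep_apply α (conjRep α ψ h), map_smul, h1,
    conjRep_apply]

lemma one_mem_homOn_conjRep {α : Z2 G} {ψ : G → W ≃ₗ[ℂ] W} {K : Subgroup G} :
    (1 : W ≃ₗ[ℂ] W).toLinearMap ∈ homOn K (conjRep α ψ 1) ψ :=
  fun x _ w => by simp [conjRep_apply, conjScalar_one_right]

/-- The elements of `L` that stabilize the representation `ψ` of the normal subgroup `M`. -/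
def stabilizerOn (α : Z2 G) (M L : Subgroup G) [M.Normal] (ψ : G → W ≃ₗ[ℂ] W) : Subgroup G where
  carrier := {g | g ∈ L ∧ ∃ y : W ≃ₗ[ℂ] W, y.toLinearMap ∈ homOn M (conjRep α ψ g) ψ}
  one_mem' := ⟨L.one_mem, 1, one_mem_homOn_conjRep⟩
  mul_mem' := by
    rintro g h ⟨hg, y, hy⟩ ⟨hh, z, hz⟩
    exact ⟨L.mul_mem hg hh, z ≪≫ₗ y, trans_mem_homOn_conjRep hy hz⟩
  inv_mem' := by
    rintro g ⟨hg, y, hy⟩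
    refine ⟨L.inv_mem hg, y.symm, fun x hx w => ?_⟩
    simp only [LinearEquiv.coe_coe]
    have hx' : g⁻¹⁻¹ * x * g⁻¹ ∈ M := inv_mul_mul_mem hx _
    have h1 := hy _ hx' (y.symm w)
    simp only [LinearEquiv.coe_coe, LinearEquiv.apply_symm_apply] at h1
    rw [LinearEquiv.symm_apply_eq, conjRep_apply, ← h1, ← map_smul]
    congr 1
    have h2 := conjRep_conjRep_apply α ψ g⁻¹ g x (y.symm w)
    rw [conjRep_apply α (conjRep α ψ g)] at h2
    rw [h2, conjRep_apply, inv_mul_cancel, conjScalar_one_right]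
    simp

lemma traceOperator_hom_apply (K : Subgroup G) [Fintype K] {θ : G → U ≃ₗ[ℂ] U}
    {ψ : G → W ≃ₗ[ℂ] W} {φ : G → V ≃ₗ[ℂ] V} {f : W →ₗ[ℂ] V} (hf : f ∈ homOn K ψ φ)
    (B : U →ₗ[ℂ] U) (w : W) : traceOperator K θ φ B (f w) = f (traceOperator K θ ψ B w) := by
  rw [traceOperator_apply, traceOperator_apply, map_sum]
  exact Finset.sum_congr rfl fun g _ => by rw [map_smul, hf g g.2]

/-- φ(g) conjugates the operator of ψ into that of the conjugate ψ^g, as it moves the ψ-isotypic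
component to the ψ^g-isotypic one. -/
lemma traceOperator_conjRep [Fintype M] {α : Z2 G}
    {ψ : G → W ≃ₗ[ℂ] W} {φ : G → V ≃ₗ[ℂ] V} (hφ : IsTwistedOn α.1 L φ) (hML : M ≤ L) {g : G}
    (hg : g ∈ L) (v : V) :
    traceOperator M (conjRep α ψ g) φ 1 (φ g v) = φ g (traceOperator M ψ φ 1 v) := by
  rw [traceOperator_apply, traceOperator_apply, map_sum,
    ← Equiv.sum_comp (MulAut.conjNormal g⁻¹ : MulAut M).toEquiv
      (fun m : M => φ g (LinearMap.trace ℂ W ((ψ m).symm.toLinearMap ∘ₗ 1) • φ m v))]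
  refine Finset.sum_congr rfl fun m _ => ?_
  have h1 : ((conjRep α ψ g m).symm.toLinearMap ∘ₗ (1 : W →ₗ[ℂ] W))
      = (conjScalar α m g : ℂ)⁻¹ • ((ψ (g⁻¹ * m * g)).symm.toLinearMap ∘ₗ 1) :=
    LinearMap.ext fun w => conjRep_symm_apply α ψ g m w
  have h2 : (((MulAut.conjNormal g⁻¹ : MulAut M).toEquiv m : M) : G) = g⁻¹ * m * g := by simp
  rw [h1, h2, hφ.apply_apply_conj (hML m.2) hg, map_smul, smul_smul, smul_eq_mul, mul_right_comm,
    inv_mul_cancel₀ (Units.ne_zero _), one_mul, map_smul]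

lemma traceOperator_congr {K : Subgroup G} [Fintype K] {ψ : G → W ≃ₗ[ℂ] W} {θ : G → U ≃ₗ[ℂ] U}
    (φ : G → V ≃ₗ[ℂ] V) {y : W ≃ₗ[ℂ] U} (hy : y.toLinearMap ∈ homOn K ψ θ) :
    traceOperator K ψ φ 1 = traceOperator K θ φ 1 := by
  refine Finset.sum_congr rfl fun g _ => ?_
  have h : (θ g).symm.toLinearMap ∘ₗ (1 : U →ₗ[ℂ] U)
      = y.conj ((ψ g).symm.toLinearMap ∘ₗ (1 : W →ₗ[ℂ] W)) := by
    ext u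
    change (θ g).symm u = y ((ψ g).symm (y.symm u))
    rw [LinearEquiv.symm_apply_eq]
    have h1 := hy g g.2 ((ψ g).symm (y.symm u))
    simp only [LinearEquiv.coe_coe, LinearEquiv.apply_symm_apply] at h1
    exact h1
  rw [h, LinearMap.trace_conj']

/-- A homomorphism whose values lie in the span of the values of a space `X` of homomorphisms from
an irreducible representation is in `X`. -/
lemma mem_of_forall_apply_mem_span [FiniteDimensional ℂ W] {α : G → G → ℂˣ} {K : Subgroup G}
    [Finite K] {ψ : G → W ≃ₗ[ℂ] W} {φ : G → V ≃ₗ[ℂ] V} (hψ : IsTwistedOn α K ψ)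
    (hi : IsIrreducibleOn K ψ) {X : Submodule ℂ (W →ₗ[ℂ] V)} (hX : X ≤ homOn K ψ φ)
    {f : W →ₗ[ℂ] V} (hf : f ∈ homOn K ψ φ)
    (h : ∀ w, f w ∈ Submodule.span ℂ {v | ∃ g ∈ X, ∃ w, g w = v}) : f ∈ X := by
  have := Fintype.ofFinite K
  have := hi.1
  by_contra hfX
  obtain ⟨l, hlf, hlX⟩ := Submodule.exists_le_ker_of_notMem hfX
  obtain ⟨w, hw⟩ := exists_ne (0 : W)
  obtain ⟨ξ, hξ, -⟩ := Submodule.exists_le_ker_of_notMem (p := (⊥ : Submodule ℂ W)) (v := w)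
    (by simpa using hw)
  -- By orthogonality, averaging the rank-one map ξ ⊗ g(w) recovers g up to the scalar (|K| / dim W)
  -- ξ(w). So v ↦ l(average of ξ ⊗ v) vanishes on the span of the images of `X`, but not at `f w`.
  have key : ∀ g ∈ homOn K ψ φ, ∀ w, l (averageOn K ψ φ (ξ.smulRight (g w)))
      = ((Nat.card K : ℂ) / finrank ℂ W * ξ w) * l g := by
    intro g hg w
    have h1 : averageOn K ψ φ (ξ.smulRight (g w))
        = ((Nat.card K : ℂ) / finrank ℂ W * ξ w) • g := by
      ext w'
      rw [LinearMap.smul_apply, ← map_smul, ← LinearMap.trace_smulRight ξ w,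
        ← averageOn_apply_self hψ hi, averageOn_apply, averageOn_apply, map_sum]
      exact Finset.sum_congr rfl fun k _ => by
        rw [hg k k.2, LinearMap.smulRight_apply, LinearMap.smulRight_apply, map_smul, map_smul,
          map_smul]
    rw [h1, map_smul, smul_eq_mul]
  have hker : ∀ v ∈ Submodule.span ℂ {v | ∃ g ∈ X, ∃ w, g w = v},
      l (averageOn K ψ φ (ξ.smulRight v)) = 0 := by
    intro v hv
    induction hv using Submodule.span_induction with
    | mem v hv =>
      obtain ⟨g, hg, w, rfl⟩ := hv
      rw [key g (hX hg), LinearMap.mem_ker.1 (hlX hg), mul_zero]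
    | zero => simp
    | add a b _ _ ha hb =>
      rw [show ξ.smulRight (a + b) = ξ.smulRight a + ξ.smulRight b by ext; simp, map_add, map_add,
        ha, hb, add_zero]
    | smul c a _ ha =>
      rw [show ξ.smulRight (c • a) = c • ξ.smulRight a by ext; simp [smul_smul, mul_comm],
        map_smul, map_smul, ha, smul_zero]
  have h2 := key f hf w
  rw [hker _ (h w)] at h2
  have h3 : (finrank ℂ W : ℂ) ≠ 0 := Nat.cast_ne_zero.2 finrank_pos.ne'
  have h4 : (Nat.card K : ℂ) ≠ 0 := Nat.cast_ne_zero.2 Nat.card_pos.ne'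
  exact mul_ne_zero (mul_ne_zero (div_ne_zero h4 h3) hξ) hlf h2.symm

end Clifford

/-! ### Clifford theory of degrees over a normal subgroup -/

section Clifford

variable {G : Type*} [Group G] {V W : Type*}
  [AddCommGroup V] [Module ℂ V] [AddCommGroup W] [Module ℂ W]
  {M L : Subgroup G} [M.Normal] {α : Z2 G} {ψ : G → W ≃ₗ[ℂ] W} {φ : G → V ≃ₗ[ℂ] V}

/-- φ(g) carries a copy of ψ inside φ to a copy of its conjugate by g. -/
lemma comp_mem_homOn_conjRep (hφ : IsTwistedOn α.1 L φ) (hML : M ≤ L) {g : G} (hg : g ∈ L)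
    {f : W →ₗ[ℂ] V} (hf : f ∈ homOn M ψ φ) :
    (φ g).toLinearMap ∘ₗ f ∈ homOn M (conjRep α ψ g) φ := by
  intro x hx w
  change φ g (f (conjRep α ψ g x w)) = φ x (φ g (f w))
  rw [hφ.apply_apply_conj (hML hx) hg, conjRep_apply, map_smul, map_smul,
    hf _ (inv_mul_mul_mem hx g)]

lemma exists_equiv_of_homOn_ne_bot {K : Subgroup G} (hψ : IsIrreducibleOn K ψ)
    (hφ : IsIrreducibleOn K φ) (h : homOn K ψ φ ≠ ⊥) :
    ∃ y : W ≃ₗ[ℂ] V, y.toLinearMap ∈ homOn K ψ φ := by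
  obtain ⟨f, hf, h0⟩ := Submodule.exists_mem_ne_zero_of_ne_bot h
  exact ⟨LinearEquiv.ofBijective f
    ⟨injective_of_mem_homOn hψ hf h0, surjective_of_mem_homOn hφ hf h0⟩, hf⟩

lemma symm_mem_homOn {K : Subgroup G} {y : W ≃ₗ[ℂ] V} (hy : y.toLinearMap ∈ homOn K ψ φ) :
    y.symm.toLinearMap ∈ homOn K φ ψ := by
  intro x hx v
  have h := hy x hx (y.symm v)
  simp only [LinearEquiv.coe_coe, LinearEquiv.apply_symm_apply] at h ⊢
  rw [← h, LinearEquiv.symm_apply_apply]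

lemma homOn_conjRep_eq_bot (hi : IsIrreducibleOn M ψ) {g : G} (hg : g ∈ L)
    (hgT : g ∉ stabilizerOn α M L ψ) : homOn M ψ (conjRep α ψ g) = ⊥ := by
  by_contra h
  obtain ⟨y, hy⟩ := exists_equiv_of_homOn_ne_bot hi (hi.conjRep g) h
  exact hgT ⟨hg, y.symm, symm_mem_homOn hy⟩

lemma stabilizerOn_le : stabilizerOn α M L ψ ≤ L := fun _ hg => hg.1

lemma le_stabilizerOn (hψ : IsTwistedOn α.1 M ψ) (hML : M ≤ L) : M ≤ stabilizerOn α M L ψ := by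
  refine fun m hm => ⟨hML hm, ψ m, fun x hx w => ?_⟩
  simp only [LinearEquiv.coe_coe]
  rw [conjRep_apply, map_smul, hψ.apply_apply_conj hx hm]

lemma traceOperator_apply_conj_eq_zero [Fintype M] [FiniteDimensional ℂ W]
    (hψ : IsTwistedOn α.1 M ψ) (hi : IsIrreducibleOn M ψ) {g : G} (hg : g ∈ L)
    (hgT : g ∉ stabilizerOn α M L ψ) {f : W →ₗ[ℂ] V}
    (hf : f ∈ homOn M (conjRep α ψ g) φ) (w : W) : traceOperator M ψ φ 1 (f w) = 0 := by
  rw [traceOperator_hom_apply M hf, traceOperator_eq_zero hψ (hψ.conjRep g)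
    (homOn_conjRep_eq_bot hi hg hgT), LinearMap.zero_apply, map_zero]

/-- Up to the factor |K| / dim W, the trace operator is the projection onto the isotypic component
of ψ. -/
lemma traceOperator_traceOperator {K : Subgroup G} [Fintype K] [FiniteDimensional ℂ W]
    (hφ : IsTwistedOn α.1 K φ)
    (hψ : IsTwistedOn α.1 K ψ) (hi : IsIrreducibleOn K ψ) (v : V) :
    traceOperator K ψ φ 1 (traceOperator K ψ φ 1 v)
      = ((Nat.card K : ℂ) / finrank ℂ W) • traceOperator K ψ φ 1 v := by
  have h := traceOperator_mem_of_forall hψ hφ (X := LinearMap.ker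
    (traceOperator K ψ φ 1 - ((Nat.card K : ℂ) / finrank ℂ W) • 1)) (fun f hf w => by
      rw [LinearMap.mem_ker, LinearMap.sub_apply, traceOperator_apply_hom hψ hi hf]
      simp) 1 v
  rw [LinearMap.mem_ker, LinearMap.sub_apply, sub_eq_zero] at h
  exact h

/-- Clifford's theorem for degrees, in terms of the stabilizer and the multiplicity space. -/
lemma card_mul_finrank_mul_finrank_homOn [Finite G] [FiniteDimensional ℂ V] [FiniteDimensional ℂ W]
    (hML : M ≤ L) (hφ : IsTwistedOn α.1 L φ) (hφi : IsIrreducibleOn L φ)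
    (hψ : IsTwistedOn α.1 M ψ) (hψi : IsIrreducibleOn M ψ) (h : homOn M ψ φ ≠ ⊥) :
    Nat.card L * (finrank ℂ W * finrank ℂ (homOn M ψ φ))
      = Nat.card (stabilizerOn α M L ψ) * finrank ℂ V := by
  classical
  have := Fintype.ofFinite M
  have := Fintype.ofFinite L
  have := Fintype.ofFinite (stabilizerOn α M L ψ)
  have := hφi.1
  have := hψi.1
  obtain ⟨f, hf, hf0⟩ := Submodule.exists_mem_ne_zero_of_ne_bot h
  have hd : (finrank ℂ W : ℂ) ≠ 0 := Nat.cast_ne_zero.2 finrank_pos.ne'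
  have hn : (finrank ℂ V : ℂ) ≠ 0 := Nat.cast_ne_zero.2 finrank_pos.ne'
  have hM : (Nat.card M : ℂ) ≠ 0 := Nat.cast_ne_zero.2 Nat.card_pos.ne'
  set κ : ℂ := (Nat.card M : ℂ) / finrank ℂ W with hκ
  have hκ0 : κ ≠ 0 := div_ne_zero hM hd
  set E := traceOperator M ψ φ 1 with hE
  obtain ⟨w, hw⟩ := exists_ne (0 : W)
  set v := f w with hv
  have hv0 : v ≠ 0 := fun h0 => hw (injective_of_mem_homOn hψi hf hf0 (h0.trans (map_zero f).symm))
  have hEv : E v = κ • v := by rw [hE, hv, traceOperator_apply_hom hψ hψi hf, Module.End.one_apply]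
  -- The operator E ∑ φ(g) E φ(g)⁻¹ is evaluated at v in two ways. Termwise, g in the stabilizer
  -- contributes κ²v, and any other g projects to an isotypic component killed by E. By Schur's
  -- lemma the inner sum is the scalar (|L| / dim V) tr E.
  have hterm : ∀ g ∈ L, E (φ g (E ((φ g).symm v)))
      = if g ∈ stabilizerOn α M L ψ then κ • (κ • v) else 0 := by
    intro g hg
    rw [hE, ← traceOperator_conjRep hφ hML hg, LinearEquiv.apply_symm_apply]
    split_ifs with hgT
    · obtain ⟨-, y, hy⟩ := id hgT
      rw [traceOperator_congr φ hy, traceOperator_traceOperator (hφ.mono hML) hψ hψi, ← hE, hEv]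
    · have h1 := traceOperator_mem_of_forall (hψ.conjRep g) (hφ.mono hML)
        (X := LinearMap.ker (traceOperator M ψ φ 1)) (fun f hf w => LinearMap.mem_ker.2
          (traceOperator_apply_conj_eq_zero hψ hψi hg hgT hf w)) 1 v
      exact LinearMap.mem_ker.1 h1
  have hsum := congrArg E (averageOn_apply L φ φ E v)
  rw [map_sum, Finset.sum_congr rfl fun (g : L) _ => hterm g g.2,
    sum_ite_mem_subgroup stabilizerOn_le fun _ => κ • (κ • v),
    averageOn_apply_self hφ hφi, map_smul, hEv] at hsum
  have htr : LinearMap.trace ℂ V E = Nat.card M * finrank ℂ (homOn M ψ φ) := by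
    rw [← sum_trace_mul_trace hψ (hφ.mono hML), hE, traceOperator, map_sum]
    refine Finset.sum_congr rfl fun g _ => ?_
    rw [map_smul, smul_eq_mul]
    rfl
  rw [htr, Finset.sum_const, Finset.card_univ, ← Nat.card_eq_fintype_card,
    ← Nat.cast_smul_eq_nsmul ℂ, smul_smul, smul_smul, smul_smul] at hsum
  have h1 := smul_left_injective ℂ hv0 hsum
  rw [← mul_assoc] at h1
  have h2 := mul_right_cancel₀ hκ0 h1
  rw [hκ] at h2
  field_simp at h2
  have h3 : ((Nat.card L * (finrank ℂ W * finrank ℂ (homOn M ψ φ)) : ℕ) : ℂ)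
      = (Nat.card (stabilizerOn α M L ψ) * finrank ℂ V : ℕ) := by
    push_cast
    linear_combination h2
  exact_mod_cast h3

/-- The stabilizer acts projectively and irreducibly on the multiplicity space. -/
lemma finrank_homOn_dvd [Finite G] [FiniteDimensional ℂ V] [FiniteDimensional ℂ W]
    (hML : M ≤ L) (hφ : IsTwistedOn α.1 L φ) (hφi : IsIrreducibleOn L φ)
    (hψ : IsTwistedOn α.1 M ψ) (hψi : IsIrreducibleOn M ψ) (h : homOn M ψ φ ≠ ⊥) :
    finrank ℂ (homOn M ψ φ) ∣ M.relIndex (stabilizerOn α M L ψ) := by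
  classical
  have := Fintype.ofFinite M
  set T := stabilizerOn α M L ψ with hT
  have hTL : T ≤ L := stabilizerOn_le
  choose y hy using fun g : T => g.2.2
  have hmaps : ∀ (g : T), ∀ f ∈ homOn M ψ φ,
      ((y g).arrowCongr (φ g)).toLinearMap f ∈ homOn M ψ φ := fun g f hf =>
    homOn_comp (comp_mem_homOn_conjRep hφ hML (hTL g.2) hf) (symm_mem_homOn (hy g))
  -- ρ(g) f = φ(g) f y_g⁻¹. It is only projective because y_g is determined up to a scalar.
  let ρ : T → homOn M ψ φ ≃ₗ[ℂ] homOn M ψ φ := fun g => LinearEquiv.ofInjectiveEndo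
    (((y g).arrowCongr (φ g)).toLinearMap.restrict (hmaps g)) fun a b hab =>
      Subtype.ext (((y g).arrowCongr (φ g)).injective (congrArg Subtype.val hab))
  have hρ : ∀ (g : T) (f : homOn M ψ φ) (w : W),
      (ρ g f : W →ₗ[ℂ] V) w = φ g ((f : W →ₗ[ℂ] V) ((y g).symm w)) := fun g f w => rfl
  have hρ' : ∀ (g : T) (f : homOn M ψ φ) (w : W),
      (ρ g f : W →ₗ[ℂ] V) (y g w) = φ g ((f : W →ₗ[ℂ] V) w) := fun g f w => by
    rw [hρ, LinearEquiv.symm_apply_apply]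
  have hyconj : ∀ (g : T), ∀ x ∈ M, ∀ w, (y g).symm (ψ x (y g w)) = conjRep α ψ g x w := by
    intro g x hx w
    rw [LinearEquiv.symm_apply_eq]
    exact (hy g x hx w).symm
  refine finrank_dvd_index (M.subgroupOf T) (φ := ρ) (fun a b => ?_) (fun a ha => ?_)
    ⟨?_, fun X hX => ?_⟩
  · obtain ⟨c, hc⟩ := exists_units_smul_of_conj_eq hψi (y := y (a * b)) (z := y b ≪≫ₗ y a) (by
      intro x hx w
      simp only [LinearEquiv.trans_apply, LinearEquiv.symm_trans_apply]
      rw [hyconj a x hx, conjRep_apply, map_smul, hyconj b _ (inv_mul_mul_mem hx _),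
        hyconj _ x hx, Subgroup.coe_mul, ← conjRep_conjRep_apply, conjRep_apply α (conjRep α ψ b)])
    refine ⟨c⁻¹ * α.1 a b, fun f => Subtype.ext (LinearMap.ext fun w => ?_)⟩
    obtain ⟨w, rfl⟩ := (y b ≪≫ₗ y a).surjective w
    have h1 : (ρ a (ρ b f) : W →ₗ[ℂ] V) ((y b ≪≫ₗ y a) w)
        = (α.1 a b : ℂ) • φ (a * b) ((f : W →ₗ[ℂ] V) w) := by
      rw [LinearEquiv.trans_apply, hρ', hρ', hφ _ (hTL a.2) _ (hTL b.2)]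
    rw [h1, Submodule.coe_smul, LinearMap.smul_apply, hc, map_smul, hρ', smul_smul, ← Units.val_mul,
      Subgroup.coe_mul]
    congr 2
    rw [mul_right_comm, inv_mul_cancel, one_mul]
  -- For a in M, y_a is a multiple of ψ(a), which f intertwines with φ(a); so a acts by a scalar.
  · have ha : (a : G) ∈ M := ha
    obtain ⟨c, hc⟩ := exists_units_smul_of_conj_eq hψi (y := y a) (z := ψ a) (by
      intro x hx w
      rw [hyconj a x hx, eq_comm, LinearEquiv.symm_apply_eq, conjRep_apply, map_smul,
        hψ.apply_apply_conj hx ha])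
    refine ⟨c, fun f => Subtype.ext (LinearMap.ext fun w => ?_)⟩
    obtain ⟨w, rfl⟩ := (y a).surjective w
    rw [hρ', ← f.2 _ ha, hc, map_smul]
    rfl
  · obtain ⟨f, hf, hf0⟩ := Submodule.exists_mem_ne_zero_of_ne_bot h
    exact ⟨⟨f, hf⟩, 0, fun h0 => hf0 (congrArg Subtype.val h0)⟩
  · by_cases hXb : X = ⊥
    · exact Or.inl hXb
    right
    obtain ⟨f₀, hf₀X, hf₀⟩ := Submodule.exists_mem_ne_zero_of_ne_bot hXb
    -- The L-translates of the images of `X` span V. Applying the trace operator of ψ kills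
    -- translates by elements outside T and returns the others to the span of the images of `X`; so
    -- every intertwiner takes values in that span.
    let Y : Submodule ℂ V := Submodule.span ℂ
      {v | ∃ g ∈ L, ∃ f ∈ X, ∃ w, φ g ((f : W →ₗ[ℂ] V) w) = v}
    have hY : Y = ⊤ := by
      refine (hφi.2 Y fun x hx v hv => ?_).resolve_left fun hbot => hf₀ ?_
      · induction hv using Submodule.span_induction with
        | mem v hv =>
          obtain ⟨g, hg, f, hf, w, rfl⟩ := hv
          rw [hφ x hx g hg]
          exact Y.smul_mem _ (Submodule.subset_span ⟨x * g, L.mul_mem hx hg, f, hf, w, rfl⟩)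
        | zero => simp
        | add a b _ _ ha hb => rw [map_add]; exact Y.add_mem ha hb
        | smul c a _ ha => rw [map_smul]; exact Y.smul_mem _ ha
      · refine Subtype.ext (LinearMap.ext fun w => (φ 1).injective ?_)
        have h1 : φ 1 ((f₀ : W →ₗ[ℂ] V) w) ∈ Y :=
          Submodule.subset_span ⟨1, L.one_mem, f₀, hf₀X, w, rfl⟩
        rw [hbot, Submodule.mem_bot] at h1
        rw [h1]
        simp
    have hd : (finrank ℂ W : ℂ) ≠ 0 := by
      have := hψi.1
      exact Nat.cast_ne_zero.2 finrank_pos.ne'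
    have hM : (Nat.card M : ℂ) ≠ 0 := Nat.cast_ne_zero.2 Nat.card_pos.ne'
    let Z : Submodule ℂ V := Submodule.span ℂ
      {v | ∃ g ∈ X.map (homOn M ψ φ).subtype, ∃ w, g w = v}
    have hEY : ∀ v ∈ Y, traceOperator M ψ φ 1 v ∈ Z := by
      intro v hv
      induction hv using Submodule.span_induction with
      | mem v hv =>
        obtain ⟨g, hg, f, hf, w, rfl⟩ := hv
        by_cases hgT : g ∈ T
        · rw [← hρ' ⟨g, hgT⟩, traceOperator_apply_hom hψ hψi (ρ ⟨g, hgT⟩ f).2]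
          exact Z.smul_mem _ (Submodule.subset_span
            ⟨_, ⟨_, hX ⟨g, hgT⟩ trivial f hf, rfl⟩, _, rfl⟩)
        · have h1 := traceOperator_apply_conj_eq_zero hψ hψi hg hgT
            (comp_mem_homOn_conjRep hφ hML hg f.2) w
          rw [LinearMap.comp_apply] at h1
          exact (show traceOperator M ψ φ 1 (φ g ((f : W →ₗ[ℂ] V) w)) = 0 from h1) ▸ Z.zero_mem
      | zero => simp
      | add a b _ _ ha hb => rw [map_add]; exact Z.add_mem ha hb
      | smul c a _ ha => rw [map_smul]; exact Z.smul_mem _ ha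
    rw [eq_top_iff]
    rintro ⟨f, hf⟩ -
    have hfX : f ∈ X.map (homOn M ψ φ).subtype := by
      refine mem_of_forall_apply_mem_span hψ hψi (Submodule.map_subtype_le _ X) hf fun w => ?_
      have h1 := hEY (f w) (hY ▸ Submodule.mem_top)
      rw [traceOperator_apply_hom hψ hψi hf] at h1
      exact (Z.smul_mem_iff (div_ne_zero hM hd)).1 h1
    obtain ⟨f', hf', rfl⟩ := hfX
    exact hf'

/-- If an irreducible representation of a normal subgroup occurs in an irreducible representation
then the quotient of the degrees divides the index. -/
theorem exists_finrank_eq_mul [Finite G] [FiniteDimensional ℂ V] [FiniteDimensional ℂ W]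
    (hML : M ≤ L) (hφ : IsTwistedOn α.1 L φ) (hφi : IsIrreducibleOn L φ)
    (hψ : IsTwistedOn α.1 M ψ) (hψi : IsIrreducibleOn M ψ) (h : homOn M ψ φ ≠ ⊥) :
    ∃ k, finrank ℂ V = k * finrank ℂ W ∧ k ∣ M.relIndex L := by
  have h1 := card_mul_finrank_mul_finrank_homOn hML hφ hφi hψ hψi h
  have hTL : stabilizerOn α M L ψ ≤ L := stabilizerOn_le
  have h2 := Subgroup.relIndex_mul_relIndex ⊥ _ L bot_le hTL
  rw [Subgroup.relIndex_bot_left, Subgroup.relIndex_bot_left] at h2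
  -- The quotient is the number of conjugates, |L : T|, times the multiplicity; the latter divides
  -- |T : M|.
  refine ⟨(stabilizerOn α M L ψ).relIndex L * finrank ℂ (homOn M ψ φ), ?_, ?_⟩
  · rw [← h2] at h1
    refine Nat.eq_of_mul_eq_mul_left (Nat.card_pos (α := stabilizerOn α M L ψ)) ?_
    rw [← h1]
    ring
  · rw [← Subgroup.relIndex_mul_relIndex M _ L (le_stabilizerOn hψ hML) hTL, mul_comm]
    exact Nat.mul_dvd_mul_right (finrank_homOn_dvd hML hφ hφi hψ hψi h) _

end Clifford

/-! ### Arithmetic of O_π and Hall subgroups -/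

section PiCore

variable {G : Type u} [Group G]

lemma coprime_of_primeDivisors {π : Set Nat.Primes} {m n : ℕ} (hm : primeDivisors m ⊆ π)
    (hn : primeDivisors n ⊆ πᶜ) : Nat.Coprime m n := by
  by_contra h
  obtain ⟨p, hp, hpm, hpn⟩ := Nat.Prime.not_coprime_iff_dvd.1 h
  exact @hn ⟨p, hp⟩ hpn (@hm ⟨p, hp⟩ hpm)

lemma primeDivisors_mono {m n : ℕ} (h : m ∣ n) : primeDivisors m ⊆ primeDivisors n :=
  fun _ hp => hp.trans h

/-- Normal π-subgroups are closed under products, since |AB| = |A| |B : A ∩ B|; so their supremum is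
one of them. -/
lemma primeDivisors_card_piCore [Finite G] (π : Set Nat.Primes) :
    primeDivisors (Nat.card (piCore π G)) ⊆ π := by
  have hclosed : SupClosed {N : Subgroup G | N.Normal ∧ primeDivisors (Nat.card N) ⊆ π} := by
    rintro A ⟨hA, hA'⟩ B ⟨hB, hB'⟩
    refine ⟨Subgroup.sup_normal A B, fun p hp => ?_⟩
    have h1 : A.relIndex (A ⊔ B) = A.relIndex B := by
      rw [sup_comm, Subgroup.relIndex_sup_right]
    have h2 := Subgroup.relIndex_mul_relIndex ⊥ A (A ⊔ B) bot_le le_sup_left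
    rw [Subgroup.relIndex_bot_left, Subgroup.relIndex_bot_left, h1] at h2
    have hp' : (p : ℕ) ∣ Nat.card A * A.relIndex B := h2 ▸ hp
    rcases (p.2.dvd_mul).1 hp' with h | h
    · exact hA' h
    · exact hB' (h.trans (Subgroup.relIndex_dvd_card A B))
  refine (hclosed.sSup_mem (Set.toFinite _) ⟨inferInstance, fun p hp => ?_⟩ subset_rfl).2
  have : (p : ℕ) ∣ 1 := by simpa [primeDivisors] using hp
  exact absurd (Nat.dvd_one.1 this) p.2.one_lt.ne'

lemma primeDivisors_relIndex_piCoreAbove [Finite G] (N : Subgroup G) [N.Normal]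
    (π : Set Nat.Primes) : primeDivisors (N.relIndex (piCoreAbove N π)) ⊆ π := by
  have h := Subgroup.relIndex_ker (piCoreAbove N π) (QuotientGroup.mk' N)
  rw [QuotientGroup.ker_mk', piCoreAbove,
    Subgroup.map_comap_eq_self_of_surjective (QuotientGroup.mk'_surjective N)] at h
  rw [piCoreAbove, h]
  exact primeDivisors_card_piCore π

lemma le_piCoreAbove (N : Subgroup G) [N.Normal] (π : Set Nat.Primes) : N ≤ piCoreAbove N π := by
  intro x hx
  change QuotientGroup.mk' N x ∈ piCore π (G ⧸ N)
  rw [QuotientGroup.mk'_apply, (QuotientGroup.eq_one_iff x).2 hx]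
  exact one_mem _

lemma primeDivisors_index_of_piCoreAbove_eq_top [Finite G] {M : Subgroup G} [M.Normal]
    {π : Set Nat.Primes} (h : piCoreAbove M π = ⊤) : primeDivisors M.index ⊆ π := by
  have h1 := primeDivisors_relIndex_piCoreAbove M π
  rwa [h, Subgroup.relIndex_top_right] at h1

/-- |H : H ∩ M| divides both the π-number |H| and the π'-number |G : M|. -/
lemma IsHallSubgroup.le_of_primeDivisors_index [Finite G] {π : Set Nat.Primes} {H M : Subgroup G}
    [M.Normal] (hH : IsHallSubgroup π H) (hM : primeDivisors M.index ⊆ πᶜ) : H ≤ M := by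
  rw [← Subgroup.relIndex_eq_one]
  refine Nat.Coprime.eq_one_of_dvd (Nat.Coprime.coprime_dvd_left
    (Subgroup.relIndex_dvd_card M H) (coprime_of_primeDivisors hH.1 hM))
    (Subgroup.relIndex_dvd_index_of_normal M H)

/-- |M : NH| divides both the π-number |M : N| and the π'-number |G : H|. -/
lemma IsHallSubgroup.sup_eq [Finite G] {π : Set Nat.Primes} {H N M : Subgroup G}
    (hH : IsHallSubgroup π H) (hNM : N ≤ M) (hHM : H ≤ M)
    (hM : primeDivisors (N.relIndex M) ⊆ π) : N ⊔ H = M := by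
  refine le_antisymm (sup_le hNM hHM) ?_
  rw [← Subgroup.relIndex_eq_one]
  refine Nat.Coprime.eq_one_of_dvd (coprime_of_primeDivisors
    ((primeDivisors_mono (Subgroup.relIndex_dvd_of_le_left M le_sup_left)).trans hM) hH.2) ?_
  exact (Dvd.intro _ (Subgroup.relIndex_mul_index (sup_le hNM hHM))).trans
    (Subgroup.index_dvd_of_le le_sup_right)

end PiCore

/-! ### Passage between representations of a subgroup and functions on G -/

section Conversions

variable {G : Type u} [Group G] {V : Type} [AddCommGroup V] [Module ℂ V]

/-- A twisted representation of a subgroup, extended by the identity. -/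
noncomputable def TwistedRep.extend {α : Z2 G} {K : Subgroup G} (φ : TwistedRep (Z2.res K α) V)
    (g : G) : V ≃ₗ[ℂ] V := by
  classical exact if h : g ∈ K then φ.toFun ⟨g, h⟩ else 1

lemma TwistedRep.extend_coe {α : Z2 G} {K : Subgroup G} (φ : TwistedRep (Z2.res K α) V) (g : K) :
    φ.extend g = φ.toFun g := by
  simp [TwistedRep.extend]

lemma TwistedRep.isTwistedOn_extend {α : Z2 G} {K : Subgroup G}
    (φ : TwistedRep (Z2.res K α) V) : IsTwistedOn α.1 K φ.extend := by
  intro x hx y hy v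
  have h := φ.map_mul' ⟨x, hx⟩ ⟨y, hy⟩ v
  rw [← φ.extend_coe, ← φ.extend_coe, ← φ.extend_coe] at h
  exact h

lemma TwistedRep.isIrreducibleOn_extend {α : Z2 G} {K : Subgroup G}
    {φ : TwistedRep (Z2.res K α) V} (hφ : φ.IsIrreducible) : IsIrreducibleOn K φ.extend :=
  ⟨hφ.1, fun X hX => hφ.2 X fun g v hv => by
    rw [← φ.extend_coe]
    exact hX g g.2 v hv⟩

/-- The twisted representation of `K` given by a function on the whole group. -/
def TwistedRep.ofOn {α : Z2 G} {K : Subgroup G} {φ : G → V ≃ₗ[ℂ] V} (hφ : IsTwistedOn α.1 K φ) :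
    TwistedRep (Z2.res K α) V where
  toFun g := φ g
  map_mul' x y v := hφ x x.2 y y.2 v

lemma TwistedRep.isIrreducible_ofOn {α : Z2 G} {K : Subgroup G} {φ : G → V ≃ₗ[ℂ] V}
    (hφ : IsTwistedOn α.1 K φ) (hi : IsIrreducibleOn K φ) :
    (TwistedRep.ofOn hφ).IsIrreducible :=
  ⟨hi.1, fun X hX => hi.2 X fun x hx v hv => hX ⟨x, hx⟩ v hv⟩

/-- The inertia group in terms of conjugate representations. -/
lemma mem_inertia_iff {α : Z2 G} {N : Subgroup G} [N.Normal] (φ : TwistedRep (Z2.res N α) V)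
    (g : G) : g ∈ inertia α N φ ↔
      ∃ y : V ≃ₗ[ℂ] V, y.toLinearMap ∈ homOn N (conjRep α φ.extend g) φ.extend := by
  refine exists_congr fun y => ⟨fun h x hx v => ?_, fun h x v => ?_⟩
  · have h1 := h ⟨x, hx⟩ v
    rw [← φ.extend_coe, ← φ.extend_coe, MulAut.conjNormal_apply, LinearEquiv.symm_apply_eq,
      inv_inv] at h1
    exact h1.symm
  · rw [← φ.extend_coe, ← φ.extend_coe, MulAut.conjNormal_apply, LinearEquiv.symm_apply_eq,
      inv_inv]
    exact (h x x.2 v).symm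

end Conversions

/-! ### Orders of coclasses -/

section Cohomology

variable {G : Type u} [Group G] {V W : Type*}
  [AddCommGroup V] [Module ℂ V] [AddCommGroup W] [Module ℂ W]

lemma res_coclass (α : Z2 G) (K : Subgroup G) :
    SchurMultiplier.res K (coclass α) = coclass (Z2.res K α) := rfl

lemma coclass_eq_one_iff (α : Z2 G) : coclass α = 1 ↔ ∃ ζ : G → ℂˣ, coboundary ζ = α :=
  QuotientGroup.eq_one_iff α

lemma coclass_pow (α : Z2 G) (n : ℕ) : coclass α ^ n = coclass (α ^ n) := rfl

/-- The determinant of a twisted representation trivializes a power of the cocycle. -/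
lemma coclass_res_pow_finrank [FiniteDimensional ℂ V] {α : Z2 G} {K : Subgroup G}
    {φ : G → V ≃ₗ[ℂ] V} (hφ : IsTwistedOn α.1 K φ) :
    coclass (Z2.res K α) ^ finrank ℂ V = 1 := by
  rw [coclass_pow, coclass_eq_one_iff]
  refine ⟨fun x => LinearEquiv.det (φ x), Subtype.ext (funext fun x => funext fun y => ?_)⟩
  change LinearEquiv.det (φ x) * LinearEquiv.det (φ y) * (LinearEquiv.det (φ (x * y : K)))⁻¹
    = α.1 x y ^ finrank ℂ V
  rw [mul_inv_eq_iff_eq_mul]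
  apply Units.ext
  have h := det_eq_pow_of_forall_apply_eq_smul
    (f := (φ x).toLinearMap ∘ₗ (φ y).toLinearMap) (g := (φ (x * y)).toLinearMap)
    (hφ x x.2 y y.2)
  rw [LinearMap.det_comp] at h
  simpa using h

/-- Multiplying the cocycle identity over the third variable exhibits the power as the coboundary of
x ↦ ∏ α(x, z). -/
lemma coclass_pow_card [Finite G] (α : Z2 G) : coclass α ^ Nat.card G = 1 := by
  have := Fintype.ofFinite G
  rw [coclass_pow, coclass_eq_one_iff]
  refine ⟨fun x => ∏ z, α.1 x z, Subtype.ext (funext fun x => funext fun y => ?_)⟩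
  change (∏ z, α.1 x z) * (∏ z, α.1 y z) * (∏ z, α.1 (x * y) z)⁻¹ = α.1 x y ^ Nat.card G
  have h := Finset.prod_congr (s₁ := Finset.univ) rfl fun z _ => α.2 x y z
  rw [Finset.prod_mul_distrib, Finset.prod_mul_distrib, Finset.prod_const, Finset.card_univ,
    ← Nat.card_eq_fintype_card] at h
  rw [mul_inv_eq_iff_eq_mul, h]
  congr 1
  exact (Equiv.prod_comp (Equiv.mulLeft y) fun z => α.1 x z).symm

lemma res_coclass_eq_one_of_coprime [FiniteDimensional ℂ V] {α : Z2 G} {K : Subgroup G} [Finite K]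
    {φ : G → V ≃ₗ[ℂ] V} (hφ : IsTwistedOn α.1 K φ) (h : Nat.Coprime (finrank ℂ V) (Nat.card K)) :
    SchurMultiplier.res K (coclass α) = 1 := by
  have h1 := orderOf_dvd_of_pow_eq_one (coclass_res_pow_finrank hφ)
  have h2 := orderOf_dvd_of_pow_eq_one (coclass_pow_card (Z2.res K α))
  rw [res_coclass, ← orderOf_eq_one_iff]
  exact Nat.eq_one_of_dvd_coprimes h h1 h2

end Cohomology

/-! ### Consequences of irreducible restriction to N -/

section Restriction

variable {G : Type u} [Group G] {V W : Type*}
  [AddCommGroup V] [Module ℂ V] [AddCommGroup W] [Module ℂ W]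
  {M N : Subgroup G} {α : Z2 G} {ψ : G → W ≃ₗ[ℂ] W} {φ : G → V ≃ₗ[ℂ] V}

lemma IsIrreducibleOn.of_equiv {K : Subgroup G} (hψ : IsIrreducibleOn K ψ) {y : W ≃ₗ[ℂ] V}
    (hy : y.toLinearMap ∈ homOn K ψ φ) : IsIrreducibleOn K φ := by
  have := hψ.1
  refine ⟨y.symm.toEquiv.nontrivial, fun X hX => ?_⟩
  have h := hψ.2 (X.comap y.toLinearMap) (fun x hx w hw => by
    rw [Submodule.mem_comap] at hw ⊢
    rw [hy x hx]
    exact hX x hx _ hw)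
  refine h.imp (fun h => ?_) fun h => ?_
  · rw [eq_bot_iff]
    intro v hv
    obtain ⟨w, rfl⟩ := y.surjective v
    have h1 : w ∈ X.comap y.toLinearMap := hv
    rw [h, Submodule.mem_bot] at h1
    simp [h1]
  · rw [eq_top_iff]
    intro v _
    obtain ⟨w, rfl⟩ := y.surjective v
    exact (h ▸ Submodule.mem_top : w ∈ X.comap y.toLinearMap)

lemma id_mem_homOn (K : Subgroup G) (φ : G → V ≃ₗ[ℂ] V) : LinearMap.id ∈ homOn K φ φ :=
  fun _ _ _ => rfl

/-- Writing g = mn, the factors α(m, n) coming from ψ and φ cancel. This is where the trace operator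
is needed with a factor other than 1. -/
lemma sum_trace_symm_smul_coset [Fintype M] [Fintype N] [DecidablePred (· ∈ N)]
    [FiniteDimensional ℂ W] (hNM : N ≤ M)
    (hψ : IsTwistedOn α.1 M ψ) (hφ : IsTwistedOn α.1 M φ) {m : G} (hm : m ∈ M) (v : V) :
    ∑ g : M, (if m⁻¹ * g ∈ N then LinearMap.trace ℂ W (ψ g).symm.toLinearMap else 0) • φ g v
      = φ m (traceOperator N ψ φ (ψ m).symm.toLinearMap v) := by
  have h1 : ∀ g : M, (if m⁻¹ * g ∈ N then LinearMap.trace ℂ W (ψ g).symm.toLinearMap else 0) • φ g v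
      = if m⁻¹ * g ∈ N then LinearMap.trace ℂ W (ψ (m * (m⁻¹ * g))).symm.toLinearMap
        • φ (m * (m⁻¹ * g)) v else 0 := fun g => by
    rw [mul_inv_cancel_left, ite_smul, zero_smul]
  refine ((Finset.sum_congr rfl fun g _ => h1 g).trans
    (Equiv.sum_comp (Equiv.mulLeft (⟨m, hm⟩ : M)⁻¹) (fun g : M => if (g : G) ∈ N then
      LinearMap.trace ℂ W (ψ (m * g)).symm.toLinearMap • φ (m * g) v else 0))).trans ?_
  rw [sum_ite_mem_subgroup hNM fun g : G =>
      LinearMap.trace ℂ W (ψ (m * g)).symm.toLinearMap • φ (m * g) v,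
    traceOperator_apply, map_sum]
  refine Finset.sum_congr rfl fun n _ => ?_
  have h2 : (ψ n).symm.toLinearMap ∘ₗ (ψ m).symm.toLinearMap
      = (α.1 m n : ℂ)⁻¹ • (ψ (m * n)).symm.toLinearMap := by
    ext w
    obtain ⟨w, rfl⟩ := (ψ m).surjective w
    simp only [LinearMap.comp_apply, LinearEquiv.coe_coe, LinearMap.smul_apply,
      LinearEquiv.symm_apply_apply]
    rw [hψ.symm_apply_apply hm (hNM n.2), smul_smul, inv_mul_cancel₀ (Units.ne_zero _), one_smul]
  rw [h2, map_smul, map_smul, hφ m hm n (hNM n.2), smul_smul, smul_eq_mul, mul_right_comm,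
    inv_mul_cancel₀ (Units.ne_zero _), one_mul]

variable [Finite G] [FiniteDimensional ℂ V]

lemma exists_irreducible_homOn_ne_bot {K : Subgroup G} (hφ : IsTwistedOn α.1 K φ) [Nontrivial V] :
    ∃ (X : Submodule ℂ V) (ψ : G → X ≃ₗ[ℂ] X), X.subtype ∈ homOn K ψ φ ∧ IsTwistedOn α.1 K ψ ∧
      IsIrreducibleOn K ψ ∧ homOn K ψ φ ≠ ⊥ := by
  obtain ⟨X, ψ, hX, hψ, hi, v, hv, hne⟩ := exists_irreducible_submodule hφ
    (A := (LinearMap.id : V →ₗ[ℂ] V)) (fun h => by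
      obtain ⟨v, hv⟩ := exists_ne (0 : V)
      exact hv (LinearMap.congr_fun h v))
  refine ⟨X, ψ, hX, hψ, hi, fun h => hne ?_⟩
  rw [h, Submodule.mem_bot] at hX
  exact LinearMap.congr_fun hX ⟨v, hv⟩

variable [N.Normal] {π : Set Nat.Primes}

/-- The degree divided by that of a constituent on N divides the π-number |M : N| and also a
π'-number, so it is 1. -/
lemma IsIrreducibleOn.restrict (hNM : N ≤ M) (hφ : IsTwistedOn α.1 M φ)
    (hi : IsIrreducibleOn M φ) (hidx : primeDivisors (N.relIndex M) ⊆ π)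
    (hdeg : primeDivisors (finrank ℂ V) ⊆ πᶜ) : IsIrreducibleOn N φ := by
  have := hi.1
  obtain ⟨X, ψ, hX, hψ, hψi, hne⟩ := exists_irreducible_homOn_ne_bot (hφ.mono hNM)
  obtain ⟨k, hk, hdvd⟩ := exists_finrank_eq_mul hNM hφ hi hψ hψi hne
  have hk1 : k = 1 := Nat.Coprime.eq_one_of_dvd (coprime_of_primeDivisors
    ((primeDivisors_mono hdvd).trans hidx) hdeg) (Dvd.intro _ hk.symm)
  rw [hk1, one_mul] at hk
  have htop := Submodule.eq_top_of_finrank_eq hk.symm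
  exact hψi.of_equiv (y := LinearEquiv.ofBijective X.subtype ⟨X.injective_subtype, by
    rw [← LinearMap.range_eq_top, Submodule.range_subtype, htop]⟩) hX

lemma primeDivisors_finrank_of_forall {L : Subgroup G} (hML : M ≤ L) [M.Normal]
    (hL : ∀ (V : Type) [AddCommGroup V] [Module ℂ V] [FiniteDimensional ℂ V] (φ : G → V ≃ₗ[ℂ] V),
      IsTwistedOn α.1 L φ → IsIrreducibleOn L φ → primeDivisors (finrank ℂ V) ⊆ πᶜ)
    (hφ : IsTwistedOn α.1 M φ) (hi : IsIrreducibleOn M φ) :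
    primeDivisors (finrank ℂ V) ⊆ πᶜ := by
  obtain ⟨U, _, _, _, θ, hθ, hθi, hne⟩ := exists_irreducible_over α hML hφ hi
  obtain ⟨k, hk, -⟩ := exists_finrank_eq_mul hML hθ hθi hφ hi hne
  exact (primeDivisors_mono (Dvd.intro_left k hk.symm)).trans (hL U θ hθ hθi)

/-- If every irreducible representation of `M` is irreducible on `N` then the irreducible
representations of `N` are stable under `M`. -/
lemma exists_mem_homOn_conjRep (hNM : N ≤ M)
    (hM : ∀ (W : Type) [AddCommGroup W] [Module ℂ W] [FiniteDimensional ℂ W] (ψ : G → W ≃ₗ[ℂ] W),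
      IsTwistedOn α.1 M ψ → IsIrreducibleOn M ψ → IsIrreducibleOn N ψ)
    (hφ : IsTwistedOn α.1 N φ) (hi : IsIrreducibleOn N φ) {g : G} (hg : g ∈ M) :
    ∃ y : V ≃ₗ[ℂ] V, y.toLinearMap ∈ homOn N (conjRep α φ g) φ := by
  obtain ⟨W, _, _, _, ψ, hψ, hψi, hne⟩ := exists_irreducible_over α hNM hφ hi
  obtain ⟨f, hf⟩ := exists_equiv_of_homOn_ne_bot hi (hM W ψ hψ hψi) hne
  -- Through f, the representation of N extends to ψ on M, and ψ(g) itself is a stabilizing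
  -- operator.
  exact ⟨f ≪≫ₗ ψ g ≪≫ₗ f.symm,
    homOn_comp (symm_mem_homOn hf) (comp_mem_homOn_conjRep hψ hNM hg hf)⟩

/-- If every irreducible representation of `M` is irreducible on `N` then `M/N` is abelian. -/
lemma commutator_mem_of_forall_irreducible (α : Z2 G) (hNM : N ≤ M)
    (hM : ∀ (W : Type) [AddCommGroup W] [Module ℂ W] [FiniteDimensional ℂ W] (ψ : G → W ≃ₗ[ℂ] W),
      IsTwistedOn α.1 M ψ → IsIrreducibleOn M ψ → IsIrreducibleOn N ψ)
    {a b : G} (ha : a ∈ M) (hb : b ∈ M) : a * b * (b * a)⁻¹ ∈ N := by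
  classical
  have := Fintype.ofFinite M
  have := Fintype.ofFinite N
  by_contra hm
  set m := a * b * (b * a)⁻¹ with hmdef
  have hmM : m ∈ M := M.mul_mem (M.mul_mem ha hb) (M.inv_mem (M.mul_mem hb ha))
  obtain ⟨W, _, _, _, ψ, hψ, hψi, -⟩ := exists_irreducible_sum_ne_zero α M (a := fun _ => 1)
    M.one_mem one_ne_zero
  have hψN := hM W ψ hψ hψi
  -- The part of the ψ-trace sum on the coset mN minus the part on N. At 1 only the second
  -- contributes, as m ∉ N, so the element is nonzero; the rest shows that it acts as zero on every
  -- φ.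
  obtain ⟨V, _, _, _, φ, hφ, hφi, v, hv⟩ := exists_irreducible_sum_ne_zero α M
    (a := fun g => (if m⁻¹ * g ∈ N then LinearMap.trace ℂ W (ψ g).symm.toLinearMap else 0) -
      (if 1⁻¹ * g ∈ N then LinearMap.trace ℂ W (ψ g).symm.toLinearMap else 0))
    (x := 1) M.one_mem (by
      rw [if_neg (by simpa using hm), if_pos (by simp), zero_sub, neg_ne_zero]
      exact trace_symm_one_ne_zero hψ hψi)
  apply hv
  simp only [sub_smul, Finset.sum_sub_distrib]
  rw [sum_trace_symm_smul_coset hNM hψ hφ hmM, sum_trace_symm_smul_coset hNM hψ hφ M.one_mem]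
  by_cases hne : homOn N ψ φ = ⊥
  · simp [traceOperator_eq_zero (hψ.mono hNM) (hφ.mono hNM) hne]
  obtain ⟨f, hf⟩ := exists_equiv_of_homOn_ne_bot hψN (hM V φ hφ hφi) hne
  -- φ and ψ agree on N through f, so they differ on M by scalars. These are multiplicative because
  -- the cocycles agree, hence equal 1 at the commutator m.
  have hscal : ∀ g ∈ M, ∃ c : ℂˣ, ∀ w, φ g (f w) = (c : ℂ) • f (ψ g w) := by
    intro g hg
    obtain ⟨c, hc⟩ := exists_units_smul_of_conj_eq hψN (y := ψ g) (z := f ≪≫ₗ φ g ≪≫ₗ f.symm) (by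
      intro x hx w
      have e1 : ∀ w, ψ x (f.symm w) = f.symm (φ x w) := fun w => (symm_mem_homOn hf x hx w).symm
      simp only [LinearEquiv.trans_apply, LinearEquiv.symm_trans_apply, LinearEquiv.symm_symm]
      rw [LinearEquiv.symm_apply_eq, hψ.apply_apply_conj (hNM hx) hg, e1,
        LinearEquiv.apply_symm_apply, hφ.apply_apply_conj (hNM hx) hg, map_smul,
        LinearEquiv.symm_apply_apply, map_smul, map_smul]
      congr 2
      have h3 := hf _ (inv_mul_mul_mem hx g) w
      rw [LinearEquiv.coe_coe] at h3
      rw [← h3, LinearEquiv.symm_apply_apply])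
    refine ⟨c, fun w => ?_⟩
    have h2 := congrArg f (hc w)
    simpa only [LinearEquiv.trans_apply, LinearEquiv.apply_symm_apply, map_smul] using h2
  have huniq : ∀ g ∈ M, ∀ h ∈ M, ∀ c d e : ℂˣ, (∀ w, φ g (f w) = (c : ℂ) • f (ψ g w)) →
      (∀ w, φ h (f w) = (d : ℂ) • f (ψ h w)) → (∀ w, φ (g * h) (f w) = (e : ℂ) • f (ψ (g * h) w)) →
      e = c * d := by
    intro g hg h hh c d e hc hd he
    have := hψi.1
    obtain ⟨w, hw⟩ := exists_ne (0 : W)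
    have h1 := hφ g hg h hh (f w)
    rw [hd, map_smul, hc, he, hψ g hg h hh, map_smul, smul_smul, smul_smul, smul_smul] at h1
    have h2 : f (ψ (g * h) w) ≠ 0 := by simpa using hw
    have h3 := smul_left_injective ℂ h2 h1
    apply Units.ext
    refine mul_left_cancel₀ (Units.ne_zero (α.1 g h)) ?_
    rw [Units.val_mul]
    linear_combination -h3
  obtain ⟨ca, hca⟩ := hscal a ha
  obtain ⟨cb, hcb⟩ := hscal b hb
  obtain ⟨cm, hcm⟩ := hscal m hmM
  obtain ⟨cab, hcab⟩ := hscal (a * b) (M.mul_mem ha hb)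
  obtain ⟨cba, hcba⟩ := hscal (b * a) (M.mul_mem hb ha)
  have e1 := huniq a ha b hb ca cb cab hca hcb hcab
  have e2 := huniq b hb a ha cb ca cba hcb hca hcba
  have e3 := huniq m hmM (b * a) (M.mul_mem hb ha) cm cba cab hcm hcba (by
    rwa [hmdef, inv_mul_cancel_right])
  have hcm1 : cm = 1 := by
    rw [e1, e2, mul_comm cb ca] at e3
    exact (mul_eq_right.1 e3.symm)
  obtain ⟨w, rfl⟩ := f.surjective v
  have h1 := traceOperator_apply_hom (hψ.mono hNM) hψN hf (ψ m).symm.toLinearMap w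
  have h2 := traceOperator_apply_hom (hψ.mono hNM) hψN hf (ψ 1).symm.toLinearMap w
  simp only [LinearEquiv.coe_coe] at h1 h2
  have h3 : ∀ w, φ 1 (f w) = f (ψ 1 w) := fun w => by
    rw [hφ.one_apply, hψ.one_apply, map_smul]
  rw [h1, h2, map_smul, map_smul, hcm, h3, LinearEquiv.apply_symm_apply,
    LinearEquiv.apply_symm_apply, hcm1]
  simp

end Restriction

/-! ### Commuting operators -/

section CommonEigenvector

/-- A commuting family of operators has a common eigenvector. -/
lemma exists_common_eigenvector {ι V : Type*} [AddCommGroup V] [Module ℂ V] [FiniteDimensional ℂ V]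
    [Nontrivial V] (σ : ι → Module.End ℂ V) (h : ∀ i j v, σ i (σ j v) = σ j (σ i v)) :
    ∃ v ≠ 0, ∀ i, ∃ c : ℂ, σ i v = c • v := by
  let S : Set (Submodule ℂ V) := {X | X ≠ ⊥ ∧ ∀ i, ∀ v ∈ X, σ i v ∈ X}
  obtain ⟨X, ⟨hX0, hX⟩, hmin⟩ := WellFounded.has_min (wellFounded_lt (α := Submodule ℂ V)) S
    ⟨⊤, top_ne_bot, fun _ _ _ => Submodule.mem_top⟩
  obtain ⟨v, hvX, hv⟩ := Submodule.exists_mem_ne_zero_of_ne_bot hX0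
  refine ⟨v, hv, fun i => ?_⟩
  have : Nontrivial X := ⟨⟨⟨v, hvX⟩, 0, fun h => hv (congrArg Subtype.val h)⟩⟩
  obtain ⟨c, hc⟩ := Module.End.exists_eigenvalue ((σ i).restrict (hX i))
  obtain ⟨w, hw⟩ := hc.exists_hasEigenvector
  have hw1 : σ i w = c • (w : V) := congrArg Subtype.val hw.apply_eq_smul
  have hmem : Module.End.eigenspace (σ i) c ⊓ X ∈ S := by
    refine ⟨fun h0 => hw.2 ?_, fun j u hu => ?_⟩
    · have : (w : V) ∈ Module.End.eigenspace (σ i) c ⊓ X :=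
        Submodule.mem_inf.2 ⟨Module.End.mem_eigenspace_iff.2 hw1, w.2⟩
      rw [h0, Submodule.mem_bot] at this
      exact Subtype.ext this
    · obtain ⟨h1, h2⟩ := Submodule.mem_inf.1 hu
      rw [Module.End.mem_eigenspace_iff] at h1
      refine Submodule.mem_inf.2 ⟨Module.End.mem_eigenspace_iff.2 ?_, hX j u h2⟩
      rw [h, h1, map_smul]
  have heq : Module.End.eigenspace (σ i) c ⊓ X = X := by
    by_contra hne
    exact hmin _ hmem (lt_of_le_of_ne inf_le_right hne)
  exact ⟨c, Module.End.mem_eigenspace_iff.1 (Submodule.mem_inf.1 (heq.symm ▸ hvX)).1⟩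

end CommonEigenvector

/-! ### Stable representations of N and the action of H on multiplicity spaces -/

section Extension

variable {G : Type u} [Group G] {V W : Type*}
  [AddCommGroup V] [Module ℂ V] [AddCommGroup W] [Module ℂ W]
  {M N H : Subgroup G} {α : Z2 G} {ψ : G → W ≃ₗ[ℂ] W} {φ : G → V ≃ₗ[ℂ] V}

lemma symm_apply_apply_of_mem_homOn_conjRep {g : G} {y : W ≃ₗ[ℂ] W}
    (hy : y.toLinearMap ∈ homOn N (conjRep α ψ g) ψ) {x : G} (hx : x ∈ N) (w : W) :
    y.symm (ψ x (y w)) = conjRep α ψ g x w := by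
  rw [LinearEquiv.symm_apply_eq]
  exact (hy x hx w).symm

lemma exists_units_smul_of_mem_homOn_conjRep [FiniteDimensional ℂ W]
    (hψi : IsIrreducibleOn N ψ) {g : G} {y z : W ≃ₗ[ℂ] W}
    (hy : y.toLinearMap ∈ homOn N (conjRep α ψ g) ψ)
    (hz : z.toLinearMap ∈ homOn N (conjRep α ψ g) ψ) : ∃ c : ℂˣ, ∀ w, z w = (c : ℂ) • y w :=
  exists_units_smul_of_conj_eq hψi fun x hx w => by
    rw [symm_apply_apply_of_mem_homOn_conjRep hy hx, symm_apply_apply_of_mem_homOn_conjRep hz hx]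

variable [N.Normal]

lemma pow_mem_homOn_conjRep {g : G} {y : W ≃ₗ[ℂ] W}
    (hy : y.toLinearMap ∈ homOn N (conjRep α ψ g) ψ) (n : ℕ) :
    (y ^ n).toLinearMap ∈ homOn N (conjRep α ψ (g ^ n)) ψ := by
  induction n with
  | zero => simpa using one_mem_homOn_conjRep
  | succ n ih =>
    rw [pow_succ, pow_succ]
    exact trans_mem_homOn_conjRep ih hy

/-- The operators by which commuting elements of order prime to the degree stabilize an irreducible
representation commute. -/
lemma apply_comm_of_coprime [FiniteDimensional ℂ W] (hψi : IsIrreducibleOn N ψ) {g h : G} {n : ℕ}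
    (hgn : g ^ n = 1) (hcop : Nat.Coprime (finrank ℂ W) n) (hgh : g * h = h * g)
    {y z : W ≃ₗ[ℂ] W} (hy : y.toLinearMap ∈ homOn N (conjRep α ψ g) ψ)
    (hz : z.toLinearMap ∈ homOn N (conjRep α ψ h) ψ) (w : W) : y (z w) = z (y w) := by
  have := hψi.1
  have hyz := trans_mem_homOn_conjRep hy hz
  have hzy := trans_mem_homOn_conjRep hz hy
  rw [hgh] at hyz
  obtain ⟨c, hc⟩ := exists_units_smul_of_mem_homOn_conjRep hψi hzy hyz
  simp only [LinearEquiv.trans_apply] at hc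
  -- From yz = c zy, taking determinants.
  have hc1 : c ^ finrank ℂ W = 1 := by
    have h1 := det_eq_pow_of_forall_apply_eq_smul (f := y.toLinearMap ∘ₗ z.toLinearMap)
      (g := z.toLinearMap ∘ₗ y.toLinearMap) hc
    rw [LinearMap.det_comp, LinearMap.det_comp, mul_comm] at h1
    have h2 : LinearMap.det z.toLinearMap * LinearMap.det y.toLinearMap ≠ 0 :=
      mul_ne_zero (LinearEquiv.isUnit_det' z).ne_zero (LinearEquiv.isUnit_det' y).ne_zero
    apply Units.ext
    rw [Units.val_pow_eq_pow_val, Units.val_one]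
    exact (mul_eq_right₀ h2).1 h1.symm
  have hpow : ∀ (k : ℕ) (w : W), (y ^ k) (z w) = ((c ^ k : ℂˣ) : ℂ) • z ((y ^ k) w) := by
    intro k
    induction k with
    | zero => intro w; simp
    | succ k ih =>
      intro w
      rw [pow_succ', LinearEquiv.mul_apply, ih, map_smul, hc, smul_smul, LinearEquiv.mul_apply,
        ← Units.val_mul, pow_succ]
  have hyn := pow_mem_homOn_conjRep hy n
  rw [hgn] at hyn
  obtain ⟨d, hd⟩ := exists_units_smul_of_mem_homOn_conjRep hψi one_mem_homOn_conjRep hyn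
  -- Since g ^ n = 1, y ^ n is a scalar and commutes with z, while moving it past z costs c ^ n.
  have hc2 : c ^ n = 1 := by
    obtain ⟨u, hu⟩ := exists_ne (0 : W)
    have h1 := hpow n u
    rw [hd, hd, map_smul, smul_comm] at h1
    have h2 : z ((1 : W ≃ₗ[ℂ] W) u) ≠ 0 := by simpa using hu
    have h3 : (1 : W ≃ₗ[ℂ] W) (z u) = (1 : ℂ) • z ((1 : W ≃ₗ[ℂ] W) u) := by simp
    rw [h3] at h1
    have h4 := (smul_right_injective W (Units.ne_zero d)) h1
    exact Units.ext (smul_left_injective ℂ h2 h4).symm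
  have hc3 : c = 1 := by
    rw [← orderOf_eq_one_iff]
    exact Nat.eq_one_of_dvd_coprimes hcop (orderOf_dvd_of_pow_eq_one hc1)
      (orderOf_dvd_of_pow_eq_one hc2)
  rw [hc, hc3, Units.val_one, one_smul]

/-- If the abelian group `H` stabilizes an irreducible representation of `N` of degree prime to
`|H|`, and the coclass is trivial on `H`, then all irreducible representations of `NH` over it have
the same degree. -/
lemma finrank_eq_of_stable [Finite G] [FiniteDimensional ℂ V] [FiniteDimensional ℂ W]
    (hsup : N ⊔ H = M)
    (hφ : IsTwistedOn α.1 M φ) (hφi : IsIrreducibleOn M φ)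
    (hψi : IsIrreducibleOn N ψ) (hne : homOn N ψ φ ≠ ⊥)
    (hcomm : ∀ g ∈ H, ∀ h ∈ H, g * h = h * g) (hα : ∀ g ∈ H, ∀ h ∈ H, α.1 g h = α.1 h g)
    (hcop : Nat.Coprime (finrank ℂ W) (Nat.card H))
    (hst : ∀ h ∈ H, ∃ y : W ≃ₗ[ℂ] W, y.toLinearMap ∈ homOn N (conjRep α ψ h) ψ) :
    finrank ℂ V = finrank ℂ W := by
  have hNM : N ≤ M := hsup ▸ le_sup_left
  have hHM : H ≤ M := hsup ▸ le_sup_right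
  choose y hy using fun h : H => hst h h.2
  have hmaps : ∀ (h : H), ∀ f ∈ homOn N ψ φ,
      ((y h).arrowCongr (φ h)).toLinearMap f ∈ homOn N ψ φ := fun h f hf =>
    homOn_comp (comp_mem_homOn_conjRep hφ hNM (hHM h.2) hf) (symm_mem_homOn (hy h))
  let σ : H → Module.End ℂ (homOn N ψ φ) := fun h =>
    ((y h).arrowCongr (φ h)).toLinearMap.restrict (hmaps h)
  have hσ : ∀ (h : H) (f : homOn N ψ φ) (w : W),
      (σ h f : W →ₗ[ℂ] V) (y h w) = φ h ((f : W →ₗ[ℂ] V) w) := fun h f w => by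
    change φ h ((f : W →ₗ[ℂ] V) ((y h).symm (y h w))) = _
    rw [LinearEquiv.symm_apply_apply]
  have : Nontrivial (homOn N ψ φ) := Submodule.nontrivial_iff_ne_bot.2 hne
  have hycomm : ∀ (g h : H) w, y g (y h w) = y h (y g w) := fun g h w =>
    apply_comm_of_coprime hψi (n := Nat.card H)
      (congrArg Subtype.val (pow_card_eq_one' (x := g))) hcop (hcomm g g.2 h h.2) (hy g) (hy h) w
  -- The operators f ↦ φ(h) f y_h⁻¹ commute because the y_h do and α is symmetric on H. The image of
  -- a common eigenvector is invariant under H, besides N, so it is all of V.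
  obtain ⟨f, hf0, hf⟩ := exists_common_eigenvector σ (by
    intro g h f
    refine Subtype.ext (LinearMap.ext fun w => ?_)
    obtain ⟨w, rfl⟩ := (y g).surjective w
    obtain ⟨w, rfl⟩ := (y h).surjective w
    rw [hσ, hσ, hycomm, hσ, hσ, hφ _ (hHM g.2) _ (hHM h.2), hφ _ (hHM h.2) _ (hHM g.2),
      hcomm g g.2 h h.2, hα g g.2 h h.2])
  have hf0' : (f : W →ₗ[ℂ] V) ≠ 0 := fun h => hf0 (Subtype.ext h)
  have hH : ∀ h ∈ H, ∀ v ∈ LinearMap.range (f : W →ₗ[ℂ] V),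
      φ h v ∈ LinearMap.range (f : W →ₗ[ℂ] V) := by
    rintro h hh _ ⟨w, rfl⟩
    obtain ⟨c, hc⟩ := hf ⟨h, hh⟩
    rw [← hσ ⟨h, hh⟩, hc]
    exact ⟨c • y ⟨h, hh⟩ w, by rw [map_smul]; rfl⟩
  have hN : ∀ n ∈ N, ∀ v ∈ LinearMap.range (f : W →ₗ[ℂ] V),
      φ n v ∈ LinearMap.range (f : W →ₗ[ℂ] V) := by
    rintro n hn _ ⟨w, rfl⟩
    exact ⟨ψ n w, f.2 n hn w⟩
  have hrange : LinearMap.range (f : W →ₗ[ℂ] V) = ⊤ := by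
    refine (hφi.2 _ fun x hx v hv => ?_).resolve_left fun h => hf0' (LinearMap.range_eq_bot.1 h)
    rw [← hsup, Subgroup.mem_sup_of_normal_left] at hx
    obtain ⟨n, hn, h, hh, rfl⟩ := hx
    refine (Submodule.smul_mem_iff _ (Units.ne_zero (α.1 n h))).1 ?_
    rw [← hφ n (hNM hn) h (hHM hh)]
    exact hN n hn _ (hH h hh v hv)
  exact (LinearEquiv.ofBijective (f : W →ₗ[ℂ] V) ⟨injective_of_mem_homOn hψi f.2 hf0',
    LinearMap.range_eq_top.1 hrange⟩).finrank_eq.symm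

lemma finrank_dvd_card_subgroup [FiniteDimensional ℂ V] {K : Subgroup G} [Finite K]
    (hφ : IsTwistedOn α.1 K φ) (hi : IsIrreducibleOn K φ) : finrank ℂ V ∣ Nat.card K :=
  finrank_dvd_card (φ := fun g : K => φ g) (fun x y => ⟨α.1 x y, hφ x x.2 y y.2⟩)
    ⟨hi.1, fun X hX => hi.2 X fun x hx => hX ⟨x, hx⟩ trivial⟩

end Extension

/-! ### Regular classes and characters -/

section RegularClasses

variable {G : Type u} [Group G]

lemma conjScalar_mul_left_of_comm (α : Z2 G) {x y g : G} (hx : g⁻¹ * x * g = x)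
    (hy : g⁻¹ * y * g = y) : conjScalar α (x * y) g = conjScalar α x g * conjScalar α y g := by
  have h := conjScalar_mul_left α x y g
  rw [hx, hy, mul_comm] at h
  exact (mul_left_cancel h).symm

lemma conjScalar_pow_left (α : Z2 G) {x g : G} (hx : g⁻¹ * x * g = x) (n : ℕ) :
    conjScalar α (x ^ n) g = conjScalar α x g ^ n := by
  induction n with
  | zero =>
    have h := conjScalar_mul_left_of_comm α (x := 1) (y := 1) (g := g) (by simp) (by simp)
    simpa using h
  | succ n ih =>
    have h1 : g⁻¹ * x ^ n * g = x ^ n := by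
      have h2 := conj_pow (i := n) (a := g⁻¹) (b := x)
      rw [inv_inv, hx] at h2
      exact h2.symm
    rw [pow_succ, conjScalar_mul_left_of_comm α h1 hx, ih, pow_succ]

lemma conjScalar_pow_right (α : Z2 G) {x g : G} (hx : g⁻¹ * x * g = x) (n : ℕ) :
    conjScalar α x (g ^ n) = conjScalar α x g ^ n := by
  induction n with
  | zero => simpa using conjScalar_one_right α x
  | succ n ih => rw [pow_succ', conjScalar_mul_right, hx, ih, pow_succ']

/-- For commuting x and g the scalar is multiplicative in powers of each, so its order divides both
m and n. -/
lemma conjScalar_eq_one_of_coprime (α : Z2 G) {x g : G} (hx : g⁻¹ * x * g = x) {m n : ℕ}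
    (hm : x ^ m = 1) (hn : g ^ n = 1) (h : Nat.Coprime m n) : conjScalar α x g = 1 := by
  have h1 : conjScalar α x g ^ m = 1 := by
    rw [← conjScalar_pow_left α hx, hm]
    simpa using conjScalar_pow_left α (x := (1 : G)) (g := g) (by simp) 0
  have h2 : conjScalar α x g ^ n = 1 := by
    rw [← conjScalar_pow_right α hx, hn, conjScalar_one_right]
  rw [← orderOf_eq_one_iff]
  exact Nat.eq_one_of_dvd_coprimes h (orderOf_dvd_of_pow_eq_one h1) (orderOf_dvd_of_pow_eq_one h2)

/-- If an element `h` of order prime to `|N|` stabilizes the `N`-class of `x`, then some element of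
`hN` of order prime to `|N|` centralizes `x`. -/
lemma exists_mul_comm_of_isConj [Finite G] {N H : Subgroup G} [N.Normal]
    (hcop : Nat.Coprime (Nat.card N) (Nat.card H)) {x h n : G} (hh : h ∈ H) (hn : n ∈ N)
    (hx : h⁻¹ * x * h = n⁻¹ * x * n) :
    ∃ k ∈ N, (h * k)⁻¹ * x * (h * k) = x ∧ (h * k) ^ Nat.card H = 1 := by
  -- hn⁻¹ centralizes x but may have order divisible by primes of |N|. Its m-th power, with m ≡ 0
  -- mod |N| and m ≡ 1 mod |H|, loses that part and stays in hN.
  obtain ⟨m, hm0, hm1⟩ := Nat.chineseRemainder hcop 0 1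
  have hhpow : h ^ Nat.card H = 1 :=
    congrArg Subtype.val (pow_card_eq_one' (x := (⟨h, hh⟩ : H)))
  have hq : ((h * n⁻¹ : G) : G ⧸ N) = (h : G ⧸ N) := by
    rw [QuotientGroup.mk_mul, (QuotientGroup.eq_one_iff n⁻¹).2 (N.inv_mem hn), mul_one]
  have hhm : h ^ m = h := by
    have h1 : h ^ m = h ^ 1 :=
      pow_eq_pow_iff_modEq.2 (hm1.of_dvd (orderOf_dvd_of_pow_eq_one hhpow))
    rwa [pow_one] at h1
  have hcomm : Commute (h * n⁻¹) x := by
    have h1 : x * h = h * (n⁻¹ * x * n) := by rw [← hx]; group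
    change h * n⁻¹ * x = x * (h * n⁻¹)
    rw [← mul_assoc x, h1]
    group
  have hk : h⁻¹ * (h * n⁻¹) ^ m ∈ N := by
    rw [← QuotientGroup.eq, QuotientGroup.mk_pow, hq, ← QuotientGroup.mk_pow, hhm]
  refine ⟨_, hk, ?_, ?_⟩
  · rw [mul_inv_cancel_left, mul_assoc, ← (hcomm.pow_left m).eq, inv_mul_cancel_left]
  · have h1 : (h * n⁻¹) ^ Nat.card H ∈ N := by
      rw [← QuotientGroup.eq_one_iff, QuotientGroup.mk_pow, hq, ← QuotientGroup.mk_pow, hhpow]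
      rfl
    obtain ⟨t, ht⟩ := (Nat.modEq_zero_iff_dvd).1 hm0
    have h2 : ((h * n⁻¹) ^ Nat.card H) ^ Nat.card N = 1 :=
      congrArg Subtype.val (pow_card_eq_one' (x := (⟨_, h1⟩ : N)))
    rw [mul_inv_cancel_left, ht, ← pow_mul, mul_right_comm, mul_comm (Nat.card N), pow_mul, pow_mul,
      h2, one_pow]

/-- Translating the summation by g centralizing x multiplies the sum by its scalar, so a scalar
other than 1 forces zero. If all these scalars are 1, the unnormalized coefficient at x counts the
centralizer. -/
lemma classSum_ne_zero_iff [Finite G] (α : Z2 G) (x : G) :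
    classSum α x ≠ 0 ↔ ∀ g, g⁻¹ * x * g = x → conjScalar α x g = 1 := by
  classical
  have := Fintype.ofFinite G
  have hc : (Nat.card (Subgroup.centralizer {x}) : ℂ)⁻¹ ≠ 0 :=
    inv_ne_zero (Nat.cast_ne_zero.2 Nat.card_pos.ne')
  rw [classSum, smul_ne_zero_iff_right hc, finsum_eq_sum_of_fintype]
  constructor
  · intro h g hg
    by_contra hne
    apply h
    have h1 : (conjScalar α x g : ℂ) • ∑ k : G, Finsupp.single (k⁻¹ * x * k) (conjScalar α x k : ℂ)
        = ∑ k : G, Finsupp.single (k⁻¹ * x * k) (conjScalar α x k : ℂ) := by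
      rw [Finset.smul_sum]
      conv_rhs => rw [← Equiv.sum_comp (Equiv.mulLeft g)]
      refine Finset.sum_congr rfl fun k _ => ?_
      rw [Equiv.coe_mulLeft, conjScalar_mul_right, hg, Finsupp.smul_single, Units.val_mul,
        smul_eq_mul, show (g * k)⁻¹ * x * (g * k) = k⁻¹ * (g⁻¹ * x * g) * k by group, hg]
    have h2 : ((conjScalar α x g : ℂ) - 1) •
        ∑ k : G, Finsupp.single (k⁻¹ * x * k) (conjScalar α x k : ℂ) = 0 := by
      rw [sub_smul, h1, one_smul, sub_self]
    refine (smul_eq_zero.1 h2).resolve_left fun h3 => hne (Units.ext ?_)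
    rw [Units.val_one, sub_eq_zero.1 h3]
  · intro h h0
    have h1 := DFunLike.congr_fun h0 x
    rw [Finsupp.finsetSum_apply, Finsupp.zero_apply] at h1
    have h2 : ∀ k : G, Finsupp.single (k⁻¹ * x * k) (conjScalar α x k : ℂ) x
        = if k⁻¹ * x * k = x then 1 else 0 := fun k => by
      rw [Finsupp.single_apply]
      split_ifs with hk
      · rw [h k hk, Units.val_one]
      · rfl
    rw [Finset.sum_congr rfl fun k _ => h2 k, Finset.sum_boole, Nat.cast_eq_zero,
      Finset.card_eq_zero] at h1
    have h3 : (1 : G) ∈ Finset.univ.filter fun k => k⁻¹ * x * k = x := by simp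
    rw [h1] at h3
    exact absurd h3 (Finset.notMem_empty _)

variable {V : Type*} [AddCommGroup V] [Module ℂ V]

lemma IsTwistedOn.trace_eq {α : Z2 G} {K : Subgroup G} {φ : G → V ≃ₗ[ℂ] V}
    (hφ : IsTwistedOn α.1 K φ) {x g : G} (hx : x ∈ K) (hg : g ∈ K) :
    LinearMap.trace ℂ V (φ x).toLinearMap
      = conjScalar α x g * LinearMap.trace ℂ V (φ (g⁻¹ * x * g)).toLinearMap := by
  rw [← smul_eq_mul, ← map_smul]
  conv_rhs => rw [← LinearMap.trace_conj' _ (φ g)]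
  congr 1
  ext v
  obtain ⟨v, rfl⟩ := (φ g).surjective v
  simp only [LinearEquiv.conj_apply, LinearMap.comp_apply, LinearEquiv.coe_coe,
    LinearEquiv.symm_apply_apply, LinearMap.smul_apply, map_smul]
  exact hφ.apply_apply_conj hx hg v

lemma trace_conjRep (α : Z2 G) (φ : G → V ≃ₗ[ℂ] V) (g x : G) :
    LinearMap.trace ℂ V (conjRep α φ g x).toLinearMap
      = conjScalar α x g * LinearMap.trace ℂ V (φ (g⁻¹ * x * g)).toLinearMap := by
  rw [← smul_eq_mul, ← map_smul]
  rfl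

lemma trace_eq_of_mem_homOn_conjRep {α : Z2 G} {K : Subgroup G} {φ : G → V ≃ₗ[ℂ] V} {g : G}
    {y : V ≃ₗ[ℂ] V} (hy : y.toLinearMap ∈ homOn K (conjRep α φ g) φ) {x : G} (hx : x ∈ K) :
    LinearMap.trace ℂ V (φ x).toLinearMap
      = conjScalar α x g * LinearMap.trace ℂ V (φ (g⁻¹ * x * g)).toLinearMap := by
  rw [← trace_conjRep]
  conv_rhs => rw [← LinearMap.trace_conj' _ y]
  congr 1
  ext v
  obtain ⟨v, rfl⟩ := y.surjective v
  simp only [LinearEquiv.conj_apply, LinearMap.comp_apply, LinearEquiv.coe_coe,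
    LinearEquiv.symm_apply_apply]
  exact (hy x hx v).symm

variable {α : Z2 G} {N : Subgroup G} {φ : G → V ≃ₗ[ℂ] V}

lemma classSum_res_ne_zero_of_trace_ne_zero [Finite G] (hφ : IsTwistedOn α.1 N φ) {x : N}
    (hx : LinearMap.trace ℂ V (φ x).toLinearMap ≠ 0) : classSum (Z2.res N α) x ≠ 0 := by
  rw [classSum_ne_zero_iff]
  intro g hg
  have h := hφ.trace_eq x.2 g.2
  rw [show (g : G)⁻¹ * x * g = x from congrArg Subtype.val hg] at h
  exact Units.ext (mul_right_cancel₀ hx (h.symm.trans (one_mul _).symm))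

/-- The coefficients are those of the twisted class sum of x, which acts as the average of φ(x); on
irreducibles this is a scalar given by the character. -/
lemma sum_sum_ite_conj_smul [Fintype N] [DecidableEq G] [N.Normal] (hφ : IsTwistedOn α.1 N φ)
    {x : G} (hx : x ∈ N) (v : V) :
    ∑ z : N, (∑ n : N, if (n : G) * x * (n : G)⁻¹ = z then (conjScalar α z n : ℂ)⁻¹ else 0) • φ z v
      = averageOn N φ φ (φ x).toLinearMap v := by
  rw [averageOn_apply]
  simp only [Finset.sum_smul]
  rw [Finset.sum_comm]
  refine Finset.sum_congr rfl fun n _ => ?_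
  have hnx : (n : G) * x * (n : G)⁻¹ ∈ N := N.mul_mem (N.mul_mem n.2 hx) (N.inv_mem n.2)
  rw [Finset.sum_eq_single (⟨_, hnx⟩ : N)]
  · obtain ⟨v, rfl⟩ := (φ n).surjective v
    rw [if_pos rfl, LinearEquiv.symm_apply_apply, hφ.apply_apply_conj hnx n.2, smul_smul,
      inv_mul_cancel₀ (Units.ne_zero _), one_smul, LinearEquiv.coe_coe]
    congr 2
    group
  · intro z _ hz
    rw [if_neg fun h => hz (Subtype.ext h.symm), zero_smul]
  · simp

/-- The character is stable if the classes on which it does not vanish are. -/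
lemma trace_eq_of_isConj [Finite G] [N.Normal] {H : Subgroup G}
    (hcop : Nat.Coprime (Nat.card N) (Nat.card H)) (hφ : IsTwistedOn α.1 N φ)
    (hst : ∀ x ∈ N, LinearMap.trace ℂ V (φ x).toLinearMap ≠ 0 → ∀ h ∈ H,
      ∃ n ∈ N, h⁻¹ * x * h = n⁻¹ * x * n) {x h : G} (hx : x ∈ N) (hh : h ∈ H) :
    LinearMap.trace ℂ V (φ x).toLinearMap
      = conjScalar α x h * LinearMap.trace ℂ V (φ (h⁻¹ * x * h)).toLinearMap := by
  have hxh := inv_mul_mul_mem hx h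
  by_cases h0 : LinearMap.trace ℂ V (φ x).toLinearMap = 0
  · rw [h0, eq_comm, mul_eq_zero]
    right
    by_contra h1
    -- If the character were nonzero at x^h, the hypothesis for h⁻¹ would make x^h conjugate in N to
    -- x, where it vanishes.
    obtain ⟨n, hn, h2⟩ := hst _ hxh h1 h⁻¹ (H.inv_mem hh)
    rw [show h⁻¹⁻¹ * (h⁻¹ * x * h) * h⁻¹ = x by group] at h2
    apply h1
    rw [hφ.trace_eq hxh hn, ← h2, h0, mul_zero]
  · obtain ⟨n, hn, h1⟩ := hst x hx h0 h hh
    obtain ⟨k, hk, h2, h3⟩ := exists_mul_comm_of_isConj hcop hh hn h1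
    have hxN : x ^ Nat.card N = 1 :=
      congrArg Subtype.val (pow_card_eq_one' (x := (⟨x, hx⟩ : N)))
    have h4 := conjScalar_eq_one_of_coprime α h2 hxN h3 hcop
    rw [conjScalar_mul_right] at h4
    have h5 : k⁻¹ * (h⁻¹ * x * h) * k = x := by simpa only [mul_inv_rev, mul_assoc] using h2
    rw [hφ.trace_eq hxh hk, h5, ← mul_assoc, ← Units.val_mul, h4, Units.val_one, one_mul]

variable [FiniteDimensional ℂ V]

/-- An irreducible representation is stable if its character is. -/
lemma exists_mem_homOn_conjRep_of_trace_eq [N.Normal] [Finite N] (hφ : IsTwistedOn α.1 N φ)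
    (hi : IsIrreducibleOn N φ) {g : G}
    (h : ∀ x ∈ N, LinearMap.trace ℂ V (φ x).toLinearMap
      = conjScalar α x g * LinearMap.trace ℂ V (φ (g⁻¹ * x * g)).toLinearMap) :
    ∃ y : V ≃ₗ[ℂ] V, y.toLinearMap ∈ homOn N (conjRep α φ g) φ := by
  have := Fintype.ofFinite N
  have := hi.1
  have hne : homOn N φ (conjRep α φ g) ≠ ⊥ := by
    intro hbot
    -- Equal characters give Hom(φ, φ^g) the dimension of End(φ), which contains the identity.
    have h1 := sum_trace_mul_trace hφ (hφ.conjRep g)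
    have h2 := sum_trace_mul_trace hφ hφ
    rw [hbot, finrank_bot, Nat.cast_zero, mul_zero, ← h2.symm.trans (Finset.sum_congr rfl
      fun x _ => by rw [trace_conjRep, ← h x x.2])] at h1
    have h3 : (Nat.card N : ℂ) ≠ 0 := Nat.cast_ne_zero.2 Nat.card_pos.ne'
    have h4 := Nat.cast_eq_zero.1 ((mul_eq_zero.1 h1).resolve_left h3)
    have h5 := id_mem_homOn N φ
    rw [Submodule.finrank_eq_zero.1 h4, Submodule.mem_bot] at h5
    obtain ⟨v, hv⟩ := exists_ne (0 : V)
    exact hv (LinearMap.congr_fun h5 v)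
  obtain ⟨y, hy⟩ := exists_equiv_of_homOn_ne_bot hi (hi.conjRep g) hne
  exact ⟨y.symm, symm_mem_homOn hy⟩

/-- Irreducible characters separate the regular classes. -/
lemma exists_conj_eq_of_forall_trace_eq [Finite G] [N.Normal] {x x' : G} (hx : x ∈ N) (hx' : x' ∈ N)
    (hreg : ∀ g ∈ N, g⁻¹ * x * g = x → conjScalar α x g = 1) (c : ℂ)
    (h : ∀ (V : Type) [AddCommGroup V] [Module ℂ V] [FiniteDimensional ℂ V] (φ : G → V ≃ₗ[ℂ] V),
      IsTwistedOn α.1 N φ → IsIrreducibleOn N φ → LinearMap.trace ℂ V (φ x).toLinearMap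
        = c * LinearMap.trace ℂ V (φ x').toLinearMap) :
    ∃ n ∈ N, n * x' * n⁻¹ = x := by
  classical
  have := Fintype.ofFinite N
  by_contra! hne
  -- The class sum of x minus c times that of x'. Its coefficient at x is nonzero, since x is
  -- regular and not conjugate to x', yet the hypothesis makes it act as zero on every irreducible.
  obtain ⟨V, _, _, _, φ, hφ, hi, v, hv⟩ := exists_irreducible_sum_ne_zero α N
    (a := fun z => (∑ n : N, if (n : G) * x * (n : G)⁻¹ = z then (conjScalar α z n : ℂ)⁻¹ else 0) -
      c * ∑ n : N, if (n : G) * x' * (n : G)⁻¹ = z then (conjScalar α z n : ℂ)⁻¹ else 0) hx (by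
    have h1 : ∀ n : N, (if (n : G) * x' * (n : G)⁻¹ = x then (conjScalar α x n : ℂ)⁻¹ else 0) = 0 :=
      fun n => if_neg (hne n n.2)
    have h2 : ∀ n : N, (if (n : G) * x * (n : G)⁻¹ = x then (conjScalar α x n : ℂ)⁻¹ else 0)
        = if (n : G) * x * (n : G)⁻¹ = x then 1 else 0 := fun n => by
      split_ifs with hn
      · rw [hreg n n.2 (by nth_rw 1 [← hn]; group), Units.val_one, inv_one]
      · rfl
    simp only [h1, h2]
    rw [Finset.sum_const_zero, mul_zero, sub_zero, Finset.sum_boole, Nat.cast_ne_zero,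
      Finset.card_ne_zero]
    exact ⟨1, by simp⟩)
  apply hv
  simp only [sub_smul, mul_smul, Finset.sum_sub_distrib]
  rw [← Finset.smul_sum, sum_sum_ite_conj_smul hφ hx, sum_sum_ite_conj_smul hφ hx',
    averageOn_apply_self hφ hi, averageOn_apply_self hφ hi, h V φ hφ hi, smul_smul, ← sub_smul]
  ring_nf
  simp

/-- A cocycle whose restriction to `N` is a given representative of the restricted coclass. -/
lemma exists_res_eq (α : Z2 G) (N : Subgroup G) {β : Z2 N} (h : coclass β = coclass (Z2.res N α)) :
    ∃ α' : Z2 G, coclass α' = coclass α ∧ Z2.res N α' = β := by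
  classical
  obtain ⟨ζ, hζ⟩ : (Z2.res N α)⁻¹ * β ∈ B2 N := QuotientGroup.eq.1 h.symm
  refine ⟨α * coboundary fun g => if hg : g ∈ N then ζ ⟨g, hg⟩ else 1, ?_, ?_⟩
  · exact (QuotientGroup.eq.2 (by rw [inv_mul_cancel_left]; exact ⟨_, rfl⟩)).symm
  · have h1 : Z2.res N (coboundary fun g => if hg : g ∈ N then ζ ⟨g, hg⟩ else 1)
        = coboundary ζ := by
      refine Subtype.ext (funext fun x => funext fun y => ?_)
      simp [Z2.res, coboundary, N.mul_mem x.2 y.2]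
      rfl
    rw [map_mul, h1, hζ, mul_inv_cancel_left]

end RegularClasses

/-! ### The implications between the three conditions -/

section DegreesPrimeTo

variable {G : Type u} [Group G] {H N M : Subgroup G} [N.Normal]

lemma StabilizesIrr.exists_mem_homOn {α : Z2 G} (h : StabilizesIrr (coclass α) H N) {V : Type}
    [AddCommGroup V] [Module ℂ V] [FiniteDimensional ℂ V] {φ : G → V ≃ₗ[ℂ] V}
    (hφ : IsTwistedOn α.1 N φ) (hi : IsIrreducibleOn N φ) {g : G} (hg : g ∈ H) :
    ∃ y : V ≃ₗ[ℂ] V, y.toLinearMap ∈ homOn N (conjRep α φ g) φ := by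
  obtain ⟨y, hy⟩ := h α rfl V (TwistedRep.ofOn hφ) (TwistedRep.isIrreducible_ofOn hφ hi) hg
  refine ⟨y, fun x hx v => ?_⟩
  have h1 := hy ⟨x, hx⟩ v
  rw [LinearEquiv.symm_apply_eq] at h1
  have h2 : ((MulAut.conjNormal g⁻¹ (⟨x, hx⟩ : N) : N) : G) = g⁻¹ * x * g := by simp
  change φ x (y v)
    = y ((conjScalar α x g : ℂ) • φ (MulAut.conjNormal g⁻¹ (⟨x, hx⟩ : N) : N) v) at h1
  rw [h2] at h1
  exact h1.symm

variable [Finite G] {π : Set Nat.Primes} [M.Normal]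

lemma primeDivisors_finrank_of_irrDegreePrimes {c : SchurMultiplier G}
    (hc : irrDegreePrimes c ⊆ πᶜ) {α : Z2 G} (hα : coclass α = c) {V : Type} [AddCommGroup V]
    [Module ℂ V] [FiniteDimensional ℂ V] {φ : G → V ≃ₗ[ℂ] V} (hφ : IsTwistedOn α.1 M φ)
    (hi : IsIrreducibleOn M φ) : primeDivisors (finrank ℂ V) ⊆ πᶜ := by
  refine primeDivisors_finrank_of_forall (L := ⊤) le_top (fun U _ _ _ θ hθ hθi p hp => hc ?_) hφ hi
  exact ⟨α, hα, U, _, _, ‹_›, ⟨θ, fun x y => hθ x trivial y trivial⟩,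
    ⟨hθi.1, fun X hX => hθi.2 X fun x _ => hX x⟩, hp⟩

lemma irreducible_restrict_of_irrDegreePrimes {c : SchurMultiplier G}
    (hc : irrDegreePrimes c ⊆ πᶜ) (hNM : N ≤ M) (hidx : primeDivisors (N.relIndex M) ⊆ π)
    {α : Z2 G} (hα : coclass α = c) (V : Type) [AddCommGroup V]
    [Module ℂ V] [FiniteDimensional ℂ V] (φ : G → V ≃ₗ[ℂ] V) (hφ : IsTwistedOn α.1 M φ)
    (hi : IsIrreducibleOn M φ) : IsIrreducibleOn N φ :=
  hi.restrict hNM hφ hidx (primeDivisors_finrank_of_irrDegreePrimes hc hα hφ hi)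

theorem stable_of_irrDegreePrimes {c : SchurMultiplier G} (hc : irrDegreePrimes c ⊆ πᶜ)
    (hNM : N ≤ M) (hHM : H ≤ M) (hidx : primeDivisors (N.relIndex M) ⊆ π)
    (hN : primeDivisors (Nat.card N) ⊆ πᶜ) (hH : primeDivisors (Nat.card H) ⊆ π) :
    IsMulCommutative H ∧ SchurMultiplier.res H c = 1 ∧ StabilizesIrr c H N := by
  obtain ⟨α, rfl⟩ := QuotientGroup.mk_surjective c
  have hirr := irreducible_restrict_of_irrDegreePrimes hc hNM hidx (α := α) rfl
  refine ⟨⟨⟨fun a b => ?_⟩⟩, ?_, fun β hβ V _ _ _ φ hφ h hh => ?_⟩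
  · have h1 := commutator_mem_of_forall_irreducible α hNM hirr (hHM a.2) (hHM b.2)
    have h2 := (Subgroup.disjoint_of_coprime_natCard (coprime_of_primeDivisors hH hN)).eq_bot
    have h3 : (a : G) * b * (b * a : G)⁻¹ ∈ H ⊓ N :=
      ⟨H.mul_mem (H.mul_mem a.2 b.2) (H.inv_mem (H.mul_mem b.2 a.2)), h1⟩
    rw [h2, Subgroup.mem_bot, mul_inv_eq_one] at h3
    exact Subtype.ext h3
  · have := Fintype.ofFinite M
    obtain ⟨W, _, _, _, ψ, hψ, hψi, -⟩ := exists_irreducible_sum_ne_zero α M (a := fun _ => 1)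
      M.one_mem one_ne_zero
    exact res_coclass_eq_one_of_coprime (hψ.mono hHM) (coprime_of_primeDivisors hH
      (primeDivisors_finrank_of_irrDegreePrimes hc rfl hψ hψi)).symm
  · exact (mem_inertia_iff φ h).2 (exists_mem_homOn_conjRep hNM
      (irreducible_restrict_of_irrDegreePrimes hc hNM hidx hβ) φ.isTwistedOn_extend
      (TwistedRep.isIrreducibleOn_extend hφ) (hHM hh))

theorem irrDegreePrimes_of_stable {c : SchurMultiplier G} (hcomm : IsMulCommutative H)
    (hres : SchurMultiplier.res H c = 1) (hst : StabilizesIrr c H N) (hsup : N ⊔ H = M)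
    (hN : primeDivisors (Nat.card N) ⊆ πᶜ) (hH : primeDivisors (Nat.card H) ⊆ π)
    (hM : primeDivisors M.index ⊆ πᶜ) : irrDegreePrimes c ⊆ πᶜ := by
  rintro p ⟨α, rfl, V, _, _, _, θ, hθ, hp⟩
  set φ := θ.toFun with hφdef
  have hφ : IsTwistedOn α.1 ⊤ φ := fun x _ y _ => θ.map_mul' x y
  have hφi : IsIrreducibleOn ⊤ φ := ⟨hθ.1, fun X hX => hθ.2 X fun x => hX x trivial⟩
  have := hφi.1
  have hNM : N ≤ M := hsup ▸ le_sup_left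
  have hα : ∀ g ∈ H, ∀ h ∈ H, α.1 g h = α.1 h g := by
    intro g hg h hh
    rw [res_coclass, coclass_eq_one_iff] at hres
    obtain ⟨ζ, hζ⟩ := hres
    have h1 : ∀ a b : H, α.1 a b = ζ a * ζ b * (ζ (a * b))⁻¹ := fun a b =>
      (congrFun (congrFun (congrArg Subtype.val hζ) a) b).symm
    rw [h1 ⟨g, hg⟩ ⟨h, hh⟩, h1 ⟨h, hh⟩ ⟨g, hg⟩, hcomm.is_comm.comm ⟨g, hg⟩, mul_comm (ζ _)]
  -- Descend to a constituent W on M, then S on N: dim V = k dim W with k dividing |G : M|, and dim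
  -- W = dim S divides |N|.
  obtain ⟨W, ψ, -, hψ, hψi, hne⟩ := exists_irreducible_homOn_ne_bot (hφ.mono (le_top : M ≤ ⊤))
  obtain ⟨k, hk, hdvd⟩ := exists_finrank_eq_mul le_top hφ hφi hψ hψi hne
  have := hψi.1
  obtain ⟨S, χ, -, hχ, hχi, hne'⟩ := exists_irreducible_homOn_ne_bot (hψ.mono hNM)
  have hS : primeDivisors (finrank ℂ S) ⊆ πᶜ :=
    (primeDivisors_mono (finrank_dvd_card_subgroup hχ hχi)).trans hN
  have heq : finrank ℂ W = finrank ℂ S := finrank_eq_of_stable hsup hψ hψi hχi hne'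
    (fun g hg h hh => congrArg Subtype.val (hcomm.is_comm.comm (⟨g, hg⟩ : H) ⟨h, hh⟩)) hα
    (coprime_of_primeDivisors hH hS).symm
    (fun h hh => hst.exists_mem_homOn hχ hχi hh)
  have hp' : (p : ℕ) ∣ k * finrank ℂ S := by
    rw [← heq, ← hk]
    exact hp
  rw [Subgroup.relIndex_top_right] at hdvd
  rcases p.2.dvd_mul.1 hp' with h | h
  · exact hM (h.trans hdvd)
  · exact hS h

lemma stabilizesIrr_of_le_classStabilizer {c : SchurMultiplier G}
    (h : ∀ τ ∈ regularClasses (SchurMultiplier.res N c), H ≤ classStabilizer τ)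
    (hcop : Nat.Coprime (Nat.card N) (Nat.card H)) : StabilizesIrr c H N := by
  rintro α rfl V _ _ _ φ hφ g hg
  have htw := φ.isTwistedOn_extend
  refine (mem_inertia_iff φ g).2 (exists_mem_homOn_conjRep_of_trace_eq htw
    (TwistedRep.isIrreducibleOn_extend hφ) fun x hx => trace_eq_of_isConj hcop htw ?_ hx hg)
  intro x hx hx0 k hk
  have h1 : k⁻¹ ∈ classStabilizer (ConjClasses.mk (⟨x, hx⟩ : N)) :=
    h _ ⟨⟨x, hx⟩, ⟨Z2.res N α, rfl, classSum_res_ne_zero_of_trace_ne_zero htw hx0⟩, rfl⟩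
      (H.inv_mem hk)
  have h2 : IsConj (MulAut.conjNormal k⁻¹ (⟨x, hx⟩ : N)) ⟨x, hx⟩ :=
    ConjClasses.mk_eq_mk_iff_isConj.1 h1
  obtain ⟨n, hn⟩ := isConj_iff.1 h2
  refine ⟨n, n.2, ?_⟩
  have h3 := congrArg Subtype.val hn
  simp only [Subgroup.coe_mul, MulAut.conjNormal_apply, inv_inv, InvMemClass.coe_inv] at h3
  conv_rhs => rw [← h3]
  group

lemma le_classStabilizer_of_stabilizesIrr {c : SchurMultiplier G} (h : StabilizesIrr c H N)
    {τ : ConjClasses N} (hτ : τ ∈ regularClasses (SchurMultiplier.res N c)) :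
    H ≤ classStabilizer τ := by
  obtain ⟨x, ⟨β, hβ, hx⟩, rfl⟩ := hτ
  obtain ⟨α₀, rfl⟩ := QuotientGroup.mk_surjective c
  -- Regularity of x is witnessed by some cocycle β on N; a representative of c restricting exactly
  -- to β is used from here on.
  obtain ⟨α, hα, rfl⟩ := exists_res_eq α₀ N hβ
  rw [show (QuotientGroup.mk α₀ : SchurMultiplier G) = coclass α from hα.symm] at h
  rw [classSum_ne_zero_iff] at hx
  intro g hg
  have hg' : g⁻¹ ∈ H := H.inv_mem hg
  obtain ⟨n, hn, h1⟩ := exists_conj_eq_of_forall_trace_eq (α := α) x.2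
    (inv_mul_mul_mem x.2 g⁻¹)
    (fun k hk hkx => hx ⟨k, hk⟩ (Subtype.ext hkx)) (conjScalar α x g⁻¹)
    (fun V _ _ _ φ hφ hi => by
      obtain ⟨y, hy⟩ := h.exists_mem_homOn hφ hi hg'
      exact trace_eq_of_mem_homOn_conjRep hy x.2)
  refine ConjClasses.mk_eq_mk_iff_isConj.2 (isConj_iff.2 ⟨⟨n, hn⟩, Subtype.ext ?_⟩)
  rw [← h1]
  simp [mul_assoc]

end DegreesPrimeTo

theorem mainTheorem5 {G : Type u} [Group G] [Finite G] (π : Set Nat.Primes)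
    (hG : piCoreThree πᶜ π πᶜ G = ⊤) (H : Subgroup G) (hH : IsHallSubgroup π H)
    (c : SchurMultiplier G) :
    List.TFAE [
      irrDegreePrimes c ⊆ πᶜ,
      IsMulCommutative H ∧ SchurMultiplier.res H c = 1 ∧ StabilizesIrr c H (piCore πᶜ G),
      IsMulCommutative H ∧ SchurMultiplier.res H c = 1 ∧
        ∀ τ ∈ regularClasses (SchurMultiplier.res (piCore πᶜ G) c), H ≤ classStabilizer τ] := by
  have hN := primeDivisors_card_piCore (G := G) πᶜ
  have hNM := le_piCoreAbove (piCore πᶜ G) π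
  have hidx := primeDivisors_relIndex_piCoreAbove (piCore πᶜ G) π
  have hM := primeDivisors_index_of_piCoreAbove_eq_top hG
  have hHM := hH.le_of_primeDivisors_index hM
  have hsup := hH.sup_eq hNM hHM hidx
  tfae_have 1 → 2 := fun h => stable_of_irrDegreePrimes h hNM hHM hidx hN hH.1
  tfae_have 2 → 1 := fun h => irrDegreePrimes_of_stable h.1 h.2.1 h.2.2 hsup hN hH.1 hM
  tfae_have 2 → 3 := fun h => ⟨h.1, h.2.1, fun τ hτ => le_classStabilizer_of_stabilizesIrr h.2.2 hτ⟩
  tfae_have 3 → 2 := fun h => ⟨h.1, h.2.1,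
    stabilizesIrr_of_le_classStabilizer h.2.2 (coprime_of_primeDivisors hH.1 hN).symm⟩
  tfae_finish
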